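/- For an upper triangular matrix $A\in\mathbb F_2^{n\times n}$ let $f(x)=x^{\top}Ax$ (computed in $\mathbb F_2$), let $|\psi_f\rangle=2^{-n/2}\sum_{x\in\{0,1\}^n}(-1)^{f(x)}|x\rangle$ be the corresponding degree-2 phase state, and let the graph degree $\mathrm{gd}(f)$ be the maximal number of nonzero entries in a row of $A+A^{\top}$. Let $\mathcal D=\mathcal D_1^{\otimes n}$ be local depolarizing noise of strength $\varepsilon$, where $\mathcal D_1(\rho)=(1-\varepsilon)\rho+\varepsilon\,\mathrm{Tr}(\rho)\,I/2$. Logarithms are to base 2. **Theorem.** Let $0<\varepsilon<1$ and $\delta'<1$ be constants. There are constants $\delta\in(0,1)$, $C,c>0$ and $n_0$ and a single quantum algorithm, all depending only on $\varepsilon$ and $\delta'$, such that the following holds for every $n\ge n_0$ and every upper triangular $A\in\mathbb F_2^{n\times n}$ with $\mathrm{gd}(f)<(\log n)^{\delta'}$. Given $\lfloor 2n^{1+\delta}\rfloor$ copies of $\mathcal D(|\psi_f\rangle\langle\psi_f|)$ (and the numbers $n$ and $\lfloor 2n^{1+\delta}\rfloor$), the algorithm always halts within $n\cdot 2^{Cn/\log\log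 n}$ steps, and with probability at least $1-2^{-cn}$ it outputs $A$. Here an algorithm is a program of a random access machine (unit-cost addition, subtraction, comparison, and indirect memory access) that may apply the gates $H$, $T=\mathrm{diag}(1,e^{i\pi/4})$ and CNOT to the qubits of the given copies and to work qubits initialized to $|0\rangle$, and may measure single qubits in the computational basis; each such operation is one step, and the number of work qubits available equals the (rounded down) time bound. -/

import Mathlib

namespace PhaseLearn

/-! ### Phase states, graph degree and local depolarizing noise -/

/-- Computational basis states of a register whose qubits are labelled by `Q`. -/
abbrev Bits (Q : Type) : Type := Q → ZMod 2

/-- Operators (in particular density matrices) on a register with qubits labelled by `Q`. -/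
abbrev Op (Q : Type) : Type := Matrix (Bits Q) (Bits Q) ℂ

/-- The polynomial `f(x) = xᵀ A x` over the field with two elements. -/
def quadForm {n : ℕ} (A : Matrix (Fin n) (Fin n) (ZMod 2)) (x : Bits (Fin n)) : ZMod 2 :=
  x ⬝ᵥ (A.mulVec x)

/-- The amplitudes `2^{-n/2} (-1)^{f(x)}` of the phase state of `f(x) = xᵀ A x`. -/
noncomputable def phaseVec {n : ℕ} (A : Matrix (Fin n) (Fin n) (ZMod 2)) (x : Bits (Fin n)) : ℂ :=
  (1 / (Real.sqrt ((2 : ℝ) ^ n) : ℂ)) * (-1) ^ (quadForm A x).val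

/-- The density matrix `|ψ_f⟩⟨ψ_f|`. -/
noncomputable def phaseState {n : ℕ} (A : Matrix (Fin n) (Fin n) (ZMod 2)) : Op (Fin n) :=
  Matrix.vecMulVec (phaseVec A) (star (phaseVec A))

/-- The graph degree: the maximal number of nonzero entries in a row of `A + Aᵀ`. -/
def graphDegree {n : ℕ} (A : Matrix (Fin n) (Fin n) (ZMod 2)) : ℕ :=
  Finset.univ.sup fun i => (Finset.univ.filter fun j => (A + A.transpose) i j ≠ 0).card

/-- The single-qubit depolarizing channel `M ↦ (1 - ε) M + ε Tr(M) I/2`. -/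
noncomputable def depol (ε : ℝ) (M : Matrix (ZMod 2) (ZMod 2) ℂ) : Matrix (ZMod 2) (ZMod 2) ℂ :=
  (1 - (ε : ℂ)) • M + ((ε : ℂ) * M.trace / 2) • (1 : Matrix (ZMod 2) (ZMod 2) ℂ)

/-- Local depolarizing noise, the `n`-fold tensor power of `depol ε`: the linear map that sends
`⨂_q |u_q⟩⟨v_q|` to `⨂_q depol ε (|u_q⟩⟨v_q|)`. -/
noncomputable def localDepol (ε : ℝ) {n : ℕ} (ρ : Op (Fin n)) : Op (Fin n) :=
  fun x y => ∑ u, ∑ v, ρ u v * ∏ q, depol ε (Matrix.single (u q) (v q) 1) (x q) (y q)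

/-! ### Elementary gates and measurements -/

/-- A `2 × 2` matrix acting on qubit `q` of a register, tensored with the identity elsewhere. -/
noncomputable def onQubit {Q : Type} [Fintype Q] [DecidableEq Q] (q : Q)
    (G : Matrix (ZMod 2) (ZMod 2) ℂ) : Op Q :=
  fun x y => if ∀ p, p ≠ q → x p = y p then G (x q) (y q) else 0

/-- The Hadamard gate. -/
noncomputable def gateH : Matrix (ZMod 2) (ZMod 2) ℂ :=
  fun a b => (1 / (Real.sqrt 2 : ℂ)) * (-1) ^ (a.val * b.val)

/-- The gate `diag(1, e^{iπ/4})`. -/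
noncomputable def gateT : Matrix (ZMod 2) (ZMod 2) ℂ :=
  Matrix.diagonal fun a => Complex.exp (Complex.I * Real.pi / 4) ^ a.val

/-- The controlled-NOT gate with control `p` and target `q`. -/
noncomputable def gateCNOT {Q : Type} [Fintype Q] [DecidableEq Q] (p q : Q) : Op Q :=
  fun x y => if x = Function.update y q (y q + y p) then 1 else 0

/-- Conjugation `ρ ↦ K ρ K†`. -/
noncomputable def conjBy {Q : Type} [Fintype Q] [DecidableEq Q] (K ρ : Op Q) : Op Q :=
  K * ρ * K.conjTranspose

/-- The unnormalized state after qubit `q` has been measured in the computational basis with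
outcome `b`; its trace is the probability of that outcome. -/
noncomputable def collapse {Q : Type} [Fintype Q] [DecidableEq Q] (q : Q) (b : ZMod 2) (ρ : Op Q) :
    Op Q :=
  conjBy (onQubit q (Matrix.single b b 1)) ρ

/-! ### The machine model

A classical random access machine that controls a quantum register. The classical part has
registers and a memory whose cells are addressed by pairs of numbers; it can add and subtract
(multiplication is not a basic operation), so that with unit cost per instruction it is
polynomially equivalent to a Turing machine. The quantum part consists of `k` samples of `n` qubits
each and of `w` work qubits; the basic quantum operations are the gates `H`, `T`, `CNOT` and the
measurement of one qubit, whose outcome is written into a classical register. -/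

/-- Labels of the qubits: qubit `q` of sample `j` is `inl (j, q)`, the others are work qubits. -/
abbrev Qubits (k n w : ℕ) : Type := (Fin k × Fin n) ⊕ Fin w

/-- A reference to a qubit through the contents of classical registers. -/
inductive QRef : Type
  | sample (j q : ℕ)
  | work (r : ℕ)

/-- Programs. The arguments named `x y z i j` are names of classical registers. -/
inductive Prog : Type
  /-- do nothing -/
  | skip
  /-- `x := c` -/
  | const (x c : ℕ)
  /-- `x := y + z` -/
  | add (x y z : ℕ)
  /-- `x := max (y - z) 0` -/
  | sub (x y z : ℕ)
  /-- `x := mem[i][j]` -/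
  | load (x i j : ℕ)
  /-- `mem[i][j] := x` -/
  | store (i j x : ℕ)
  | hadamard (q : QRef)
  | tgate (q : QRef)
  | cnot (p q : QRef)
  /-- measure qubit `q` and write the outcome, 0 or 1, to `x` -/
  | measure (x : ℕ) (q : QRef)
  | seq (P R : Prog)
  /-- if `x < y` then `P` else `R` -/
  | ifLt (x y : ℕ) (P R : Prog)
  /-- while `x < y` do `P` -/
  | whileLt (x y : ℕ) (P : Prog)

/-- The classical part of the state of the machine. -/
structure Store : Type where
  reg : ℕ → ℕ
  mem : ℕ → ℕ → ℕ

/-- Write the number `v` to register `x`. -/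
def Store.setReg (s : Store) (x v : ℕ) : Store :=
  { s with reg := Function.update s.reg x v }

/-- Write the number `v` to the memory cell with address `(i, j)`. -/
def Store.setMem (s : Store) (i j v : ℕ) : Store :=
  { s with mem := Function.update s.mem i (Function.update (s.mem i) j v) }

/-- The qubit that a reference points to, if there is one. -/
def QRef.eval {k n w : ℕ} (s : Store) : QRef → Option (Qubits k n w)
  | .sample j q =>
      if h : s.reg j < k ∧ s.reg q < n then some (Sum.inl (⟨s.reg j, h.1⟩, ⟨s.reg q, h.2⟩))
      else none
  | .work r => if h : s.reg r < w then some (Sum.inr ⟨s.reg r, h⟩) else none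

open Classical in
/-- `haltProb good t L s ρ`: the probability that the machine, started with the list `L` of programs
still to be executed, the classical store `s` and the quantum state `ρ`, halts after at most `t`
steps with a final store that satisfies `good`. (For an unnormalized `ρ` this is the joint
probability with the measurement outcomes that have led to `ρ`.) A reference to a qubit that does
not exist, or a `CNOT` whose control is its target, makes the machine crash, that is, it does not
halt. -/
noncomputable def haltProb {k n w : ℕ} (good : Store → Prop) :
    ℕ → List Prog → Store → Op (Qubits k n w) → ℝ
  | _, [], s, ρ => if good s then ρ.trace.re else 0
  | 0, _ :: _, _, _ => 0
  | t + 1, .skip :: L, s, ρ => haltProb good t L s ρ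
  | t + 1, .const x c :: L, s, ρ => haltProb good t L (s.setReg x c) ρ
  | t + 1, .add x y z :: L, s, ρ => haltProb good t L (s.setReg x (s.reg y + s.reg z)) ρ
  | t + 1, .sub x y z :: L, s, ρ => haltProb good t L (s.setReg x (s.reg y - s.reg z)) ρ
  | t + 1, .load x i j :: L, s, ρ =>
      haltProb good t L (s.setReg x (s.mem (s.reg i) (s.reg j))) ρ
  | t + 1, .store i j x :: L, s, ρ =>
      haltProb good t L (s.setMem (s.reg i) (s.reg j) (s.reg x)) ρ
  | t + 1, .hadamard q :: L, s, ρ =>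
      match (q.eval s : Option (Qubits k n w)) with
      | some a => haltProb good t L s (conjBy (onQubit a gateH) ρ)
      | none => 0
  | t + 1, .tgate q :: L, s, ρ =>
      match (q.eval s : Option (Qubits k n w)) with
      | some a => haltProb good t L s (conjBy (onQubit a gateT) ρ)
      | none => 0
  | t + 1, .cnot p q :: L, s, ρ =>
      match (p.eval s : Option (Qubits k n w)), (q.eval s : Option (Qubits k n w)) with
      | some a, some b => if a = b then 0 else haltProb good t L s (conjBy (gateCNOT a b) ρ)
      | _, _ => 0
  | t + 1, .measure x q :: L, s, ρ =>
      match (q.eval s : Option (Qubits k n w)) with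
      | some a => haltProb good t L (s.setReg x 0) (collapse a 0 ρ)
          + haltProb good t L (s.setReg x 1) (collapse a 1 ρ)
      | none => 0
  | t + 1, .seq P R :: L, s, ρ => haltProb good t (P :: R :: L) s ρ
  | t + 1, .ifLt x y P R :: L, s, ρ =>
      if s.reg x < s.reg y then haltProb good t (P :: L) s ρ else haltProb good t (R :: L) s ρ
  | t + 1, .whileLt x y P :: L, s, ρ =>
      if s.reg x < s.reg y then haltProb good t (P :: .whileLt x y P :: L) s ρ
      else haltProb good t L s ρ

/-- The initial quantum state `σ^{⊗ k} ⊗ |0⟩⟨0|^{⊗ w}`. -/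
noncomputable def initState {n : ℕ} (k w : ℕ) (σ : Op (Fin n)) : Op (Qubits k n w) :=
  fun x y => (∏ j, σ (fun q => x (Sum.inl (j, q))) (fun q => y (Sum.inl (j, q)))) *
    (if ∀ r, x (Sum.inr r) = 0 ∧ y (Sum.inr r) = 0 then 1 else 0)

/-- The initial classical store: register 0 holds `n`, register 1 holds `k`, the rest is 0. -/
def initStore (n k : ℕ) : Store where
  reg := fun r => if r = 0 then n else if r = 1 then k else 0
  mem := fun _ _ => 0

/-- The probability that the program `P`, given `k` copies of the `n`-qubit state `σ` and `w` work
qubits, halts after at most `t` steps with a final store that satisfies `good`. -/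
noncomputable def runProb {n : ℕ} (P : Prog) (k w t : ℕ) (σ : Op (Fin n)) (good : Store → Prop) : ℝ :=
  haltProb good t [P] (initStore n k) (initState k w σ)

/-- The memory contains the matrix `A`, in the cells `(i, j)` with `i, j < n`. -/
def Outputs {n : ℕ} (A : Matrix (Fin n) (Fin n) (ZMod 2)) (s : Store) : Prop :=
  ∀ i j : Fin n, s.mem i j = (A i j).val

end PhaseLearn

namespace PhaseLearn

/-! The state `|ψ_f⟩` is, up to sign, a stabilizer state. Flipping bit `i` changes `f` by the affine
function `A i i + ∑ q, (A + Aᵀ) i q * u q` (`quadForm_update`). Hence `X_i ∏ Z_q`, with the product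
over the support of row `i` of `A + Aᵀ`, has expectation `sgn (A i i)` in `|ψ_f⟩`. If the support
`s` is any other vector, `X_i ∏_{s q = 1} Z_q` has expectation zero: for `s i = 0` this is
orthogonality of characters, and for `s i = 1` the corresponding statistic vanishes identically. So
each row of `A + Aᵀ`, together with the diagonal entry, can be recognised from correlations.

The algorithm measures every qubit of every copy in a computational or Hadamard basis chosen by a
fair coin. A sample is informative for the pair `(i, s)` if qubit `i` was measured in the Hadamard
basis and the support of `s` in the computational basis; the parity of the outcomes then measures
the operator above. Each qubit involved contributes `1/2` for the right basis and `1 - ε` for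
surviving the noise. The signed statistic therefore has mean `± ((1 - ε)/2)^(d + 1)` for the true
row of weight `d`, and `0` otherwise (`sum_sampleWeight_mul_testStat`).

Since `d < (log n)^δ'` with `δ' < 1`, the nonzero mean is eventually at least `n^(-1/8)` in absolute
value (`eventually_sparse`). With about `2 n^(3/2)` samples, Chernoff's inequality and a union bound
over all `n * 2^n` pairs `(i, s)` put every empirical mean within `n^(-1/8)/2` of its expectation,
except with probability at most `2^(-n)` (`concentration`, `eventually_failure_le`). On this event
the candidate with the largest absolute score is the true row, and the sign of its score is the
diagonal entry (`outputs_of_concentration`).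

The union bound covers all vectors, but the search only runs over a table of `2^⌈√n⌉` candidates.
The table contains all vectors of weight at most `log n`, because `2 n^(log n) ≤ 2^(√n)` eventually.
The running time is thus polynomial times `2^(√n)`, far below `2^(n / log log n)`.

The rest ties this to the machine. Every branch of the measurement phase applies a tensor product of
single-qubit Kraus operators (`branch_measureAll`), so its probability factors over the copies
(`MeasureInv.trace`). The post-processing is deterministic in each branch and is verified with loop
invariants and step bounds (`wp_postprocess`). -/

lemma sum_comm_pairs {α β γ δ : Type*} [Fintype α] [Fintype β] [Fintype γ] [Fintype δ]
    (F : α → β → γ → δ → ℂ) :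
    ∑ a, ∑ b, ∑ c, ∑ d, F a b c d = ∑ c, ∑ d, ∑ a, ∑ b, F a b c d := by
  calc ∑ a, ∑ b, ∑ c, ∑ d, F a b c d = ∑ a, ∑ c, ∑ b, ∑ d, F a b c d :=
        Finset.sum_congr rfl fun a _ => Finset.sum_comm
    _ = ∑ c, ∑ a, ∑ d, ∑ b, F a b c d := by
        rw [Finset.sum_comm]
        exact Finset.sum_congr rfl fun c _ => Finset.sum_congr rfl fun a _ => Finset.sum_comm
    _ = _ := Finset.sum_congr rfl fun c _ => Finset.sum_comm

lemma prod_sum_sum {ι α R : Type*} [Fintype ι] [DecidableEq ι] [Fintype α] [CommSemiring R]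
    (F : ι → α → α → R) :
    ∏ j, ∑ a, ∑ b, F j a b = ∑ Y : ι → α, ∑ Z : ι → α, ∏ j, F j (Y j) (Z j) := by
  simp only [Finset.prod_univ_sum, Fintype.piFinset_univ]

/-! ### Tensor products of single-qubit operators -/

section Tensor

variable {Q : Type} [Fintype Q]

/-- The tensor product of the single-qubit operators `K q`. -/
noncomputable def tens (K : Q → Matrix (ZMod 2) (ZMod 2) ℂ) : Op Q :=
  fun x y => ∏ q, K q (x q) (y q)

lemma tens_one : tens (fun _ : Q => (1 : Matrix (ZMod 2) (ZMod 2) ℂ)) = 1 := by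
  ext x y
  simp only [tens, Matrix.one_apply]
  by_cases h : x = y
  · simp [h]
  · obtain ⟨q, hq⟩ := Function.ne_iff.mp h
    rw [if_neg h]
    exact Finset.prod_eq_zero (Finset.mem_univ q) (if_neg hq)

variable [DecidableEq Q]

lemma tens_mul (K K' : Q → Matrix (ZMod 2) (ZMod 2) ℂ) :
    tens K * tens K' = tens fun q => K q * K' q := by
  ext x y
  simp only [Matrix.mul_apply, tens, Finset.prod_univ_sum, Fintype.piFinset_univ,
    Finset.prod_mul_distrib]

lemma onQubit_eq_tens (a : Q) (G : Matrix (ZMod 2) (ZMod 2) ℂ) :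
    onQubit a G = tens (Function.update (fun _ => 1) a G) := by
  ext x y
  simp only [onQubit, tens]
  rw [← Finset.mul_prod_erase _ _ (Finset.mem_univ a), Function.update_self]
  split_ifs with h
  · rw [Finset.prod_eq_one, mul_one]
    intro p hp
    have hpa := Finset.ne_of_mem_erase hp
    rw [Function.update_of_ne hpa, h p hpa, Matrix.one_apply_eq]
  · push Not at h
    obtain ⟨p, hpa, hp⟩ := h
    rw [Finset.prod_eq_zero (Finset.mem_erase.mpr ⟨hpa, Finset.mem_univ p⟩), mul_zero]
    rw [Function.update_of_ne hpa, Matrix.one_apply_ne hp]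

lemma onQubit_mul_tens (a : Q) (G : Matrix (ZMod 2) (ZMod 2) ℂ)
    (K : Q → Matrix (ZMod 2) (ZMod 2) ℂ) :
    onQubit a G * tens K = tens (Function.update K a (G * K a)) := by
  rw [onQubit_eq_tens, tens_mul]
  congr 1
  ext1 q
  by_cases h : q = a
  · subst h; simp
  · simp [h]

/-- Product Kraus operators are closed under single-qubit gates and measurements, and only the
factor at `a` changes. The learner uses no `CNOT`, so a family `K` of `2 × 2` matrices describes
each of its branches completely. -/
lemma conjBy_onQubit_tens (a : Q) (G : Matrix (ZMod 2) (ZMod 2) ℂ)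
    (K : Q → Matrix (ZMod 2) (ZMod 2) ℂ) (ρ : Op Q) :
    conjBy (onQubit a G) (conjBy (tens K) ρ) =
      conjBy (tens (Function.update K a (G * K a))) ρ := by
  rw [← onQubit_mul_tens]
  simp only [conjBy, Matrix.conjTranspose_mul, Matrix.mul_assoc]

lemma conjBy_tens_one (ρ : Op Q) : conjBy (tens fun _ => 1) ρ = ρ := by
  simp [conjBy, tens_one]

/-- The effect `K† K`, transposed. -/
noncomputable def gram (K : Matrix (ZMod 2) (ZMod 2) ℂ) (a b : ZMod 2) : ℂ :=
  ∑ c, K c a * star (K c b)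

/-- The Born rule for a product effect: expanding the trace, the sum over the output index factors
over the qubits into the entries of `gram`. -/
lemma trace_conjBy_tens (K : Q → Matrix (ZMod 2) (ZMod 2) ℂ) (ρ : Op Q) :
    (conjBy (tens K) ρ).trace = ∑ y, ∑ z, ρ y z * ∏ q, gram (K q) (y q) (z q) := by
  have h : ∀ y z : Bits Q, ∏ q, gram (K q) (y q) (z q) =
      ∑ x, tens K x y * star (tens K x z) := by
    intro y z
    simp only [gram, Finset.prod_univ_sum, Fintype.piFinset_univ, tens, star_prod,
      Finset.prod_mul_distrib]
  simp only [h, Matrix.trace, Matrix.diag, conjBy, Matrix.mul_apply, Matrix.conjTranspose_apply,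
    Finset.sum_mul, Finset.mul_sum]
  rw [Finset.sum_comm' (t' := Finset.univ) (s' := fun _ => Finset.univ) (by simp)]
  refine (Finset.sum_congr rfl fun z _ => Finset.sum_comm).trans ?_
  rw [Finset.sum_comm]
  refine Finset.sum_congr rfl fun y _ => Finset.sum_congr rfl fun z _ =>
    Finset.sum_congr rfl fun x _ => ?_
  ring

end Tensor

/-- Both the initial state and the effect are products over the copies and the work register, so the
probability is a product too. The work qubits start in `|0⟩`, which leaves only the `(0, 0)` entry
of their effects. -/
lemma trace_initState {n k w : ℕ} (K : Qubits k n w → Matrix (ZMod 2) (ZMod 2) ℂ) (σ : Op (Fin n)) :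
    (conjBy (tens K) (initState k w σ)).trace =
      (∏ j, ∑ y, ∑ z, σ y z * ∏ q, gram (K (Sum.inl (j, q))) (y q) (z q)) *
        ∏ r, gram (K (Sum.inr r)) 0 0 := by
  rw [trace_conjBy_tens]
  -- An assignment of bits to all qubits is split into its part on the samples and its part on the
  -- work register.
  have e : ∀ F : Bits (Qubits k n w) → ℂ, ∑ y, F y =
      ∑ p : (Fin k → Fin n → ZMod 2) × (Fin w → ZMod 2),
        F (Sum.elim (fun a => p.1 a.1 a.2) p.2) := by
    intro F
    symm
    apply Fintype.sum_equiv (((Equiv.curry _ _ _).symm.prodCongr (Equiv.refl _)).trans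
      (Equiv.sumArrowEquivProdArrow _ _ _).symm)
    intro p
    rfl
  simp only [e, initState, Fintype.sum_prod_type, Fintype.prod_sum_type, Sum.elim_inl,
    Sum.elim_inr, Fintype.prod_prod_type]
  have h1 : ∀ (y : Fin k → Fin n → ZMod 2) (u : Fin w → ZMod 2) (z : Fin k → Fin n → ZMod 2),
      ∑ v : Fin w → ZMod 2, ((∏ j, σ (fun q => y j q) fun q => z j q) *
        (if ∀ r, u r = 0 ∧ v r = 0 then (1 : ℂ) else 0)) *
        ((∏ j, ∏ q, gram (K (Sum.inl (j, q))) (y j q) (z j q)) *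
          ∏ r, gram (K (Sum.inr r)) (u r) (v r)) =
      if u = 0 then (∏ j, σ (y j) (z j) * ∏ q, gram (K (Sum.inl (j, q))) (y j q) (z j q)) *
        ∏ r, gram (K (Sum.inr r)) 0 0 else 0 := by
    intro y u z
    rw [Finset.sum_eq_single 0]
    · by_cases hu : u = 0
      · subst hu
        simp [Finset.prod_mul_distrib]
        ring
      · rw [if_neg hu, if_neg, mul_zero, zero_mul]
        intro h
        exact hu (funext fun r => (h r).1)
    · intro v _ hv
      rw [if_neg, mul_zero, zero_mul]
      intro h
      exact hv (funext fun r => (h r).2)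
    · simp
  refine Eq.trans (Finset.sum_congr rfl fun y _ => Finset.sum_congr rfl fun u _ =>
    Finset.sum_congr rfl fun z _ => h1 y u z) ?_
  have h2 := prod_sum_sum fun j (y z : Fin n → ZMod 2) =>
    σ y z * ∏ q, gram (K (Sum.inl (j, q))) (y q) (z q)
  refine Eq.trans ?_ (congrArg (· * ∏ r, gram (K (Sum.inr r)) 0 0) h2.symm)
  simp only [Finset.sum_mul]
  refine Finset.sum_congr rfl fun y _ => ?_
  rw [Finset.sum_comm]
  refine Finset.sum_congr rfl fun z _ => ?_
  rw [Finset.sum_ite_eq' Finset.univ (0 : Fin w → ZMod 2)]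
  simp

/-- The single-qubit factor of the Born rule for a depolarized qubit. -/
lemma trace_localDepol {n : ℕ} (ε : ℝ) (ρ : Op (Fin n))
    (G : Fin n → ZMod 2 → ZMod 2 → ℂ) :
    ∑ y, ∑ z, localDepol ε ρ y z * ∏ q, G q (y q) (z q) =
      ∑ u, ∑ v, ρ u v * ∏ q, ∑ a, ∑ b, depol ε (Matrix.single (u q) (v q) 1) a b * G q a b := by
  have h : ∀ u v : Bits (Fin n),
      ∏ q, ∑ a, ∑ b, depol ε (Matrix.single (u q) (v q) 1) a b * G q a b =
      ∑ y : Bits (Fin n), ∑ z : Bits (Fin n),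
        (∏ q, depol ε (Matrix.single (u q) (v q) 1) (y q) (z q)) * ∏ q, G q (y q) (z q) := by
    intro u v
    rw [prod_sum_sum]
    simp only [Finset.prod_mul_distrib]
  simp only [h, localDepol, Finset.sum_mul, Finset.mul_sum]
  rw [sum_comm_pairs]
  simp only [mul_assoc]

/-! ### Execution of programs -/

section Execution

lemma Store.reg_setReg (s : Store) (x v y : ℕ) :
    (s.setReg x v).reg y = if y = x then v else s.reg y := by
  simp [Store.setReg, Function.update_apply]

lemma Store.mem_setReg (s : Store) (x v : ℕ) : (s.setReg x v).mem = s.mem := rfl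

lemma Store.reg_setMem (s : Store) (i j v : ℕ) : (s.setMem i j v).reg = s.reg := rfl

lemma Store.mem_setMem (s : Store) (i j v a b : ℕ) :
    (s.setMem i j v).mem a b = if a = i ∧ b = j then v else s.mem a b := by
  simp only [Store.setMem, Function.update_apply]
  split_ifs <;> simp_all

/-- Sequential composition of a list of programs. -/
def block : List Prog → Prog
  | [] => .skip
  | P :: l => .seq P (block l)

/-- From the store `s`, the program `P` runs for `t` steps, without touching the qubits, and ends
with the store `s'`. -/
def Exec (P : Prog) (t : ℕ) (s s' : Store) : Prop :=
  ∀ (k n w : ℕ) (good : Store → Prop) (f : ℕ) (L : List Prog) (ρ : Op (Qubits k n w)),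
    haltProb good (f + t) (P :: L) s ρ = haltProb good f L s' ρ

/-- From the store `s`, the program `P` runs for at most `B` steps, without touching the qubits,
and ends with a store that satisfies `Post`. -/
def Wp (P : Prog) (B : ℕ) (s : Store) (Post : Store → Prop) : Prop :=
  ∃ s', Post s' ∧ ∃ t ≤ B, Exec P t s s'

variable {s s' s'' : Store} {Post Post' : Store → Prop} {P R : Prog} {l : List Prog}
  {B B' t t' x y z i j c : ℕ}

lemma Exec.skip : Exec .skip 1 s s := fun _ _ _ _ _ _ _ => by simp only [haltProb]

lemma Exec.const : Exec (.const x c) 1 s (s.setReg x c) :=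
  fun _ _ _ _ _ _ _ => by simp only [haltProb]

lemma Exec.add : Exec (.add x y z) 1 s (s.setReg x (s.reg y + s.reg z)) :=
  fun _ _ _ _ _ _ _ => by simp only [haltProb]

lemma Exec.sub : Exec (.sub x y z) 1 s (s.setReg x (s.reg y - s.reg z)) :=
  fun _ _ _ _ _ _ _ => by simp only [haltProb]

lemma Exec.load : Exec (.load x i j) 1 s (s.setReg x (s.mem (s.reg i) (s.reg j))) :=
  fun _ _ _ _ _ _ _ => by simp only [haltProb]

lemma Exec.store : Exec (.store i j x) 1 s (s.setMem (s.reg i) (s.reg j) (s.reg x)) :=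
  fun _ _ _ _ _ _ _ => by simp only [haltProb]

/-- Because `Exec` quantifies over the leftover time and the remaining programs, executions chain by
rewriting. The extra step pays for unfolding `seq`. -/
lemma Exec.seq (h : Exec P t s s') (h' : Exec R t' s' s'') :
    Exec (.seq P R) (t + t' + 1) s s'' := by
  intro k n w good f L ρ
  rw [show f + (t + t' + 1) = ((f + t') + t) + 1 by ring, haltProb, h, h']

lemma Exec.ifLt_pos (hc : s.reg x < s.reg y) (h : Exec P t s s') :
    Exec (.ifLt x y P R) (t + 1) s s' := by
  intro k n w good f L ρ
  rw [← add_assoc, haltProb, if_pos hc, h]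

lemma Exec.ifLt_neg (hc : ¬ s.reg x < s.reg y) (h : Exec R t s s') :
    Exec (.ifLt x y P R) (t + 1) s s' := by
  intro k n w good f L ρ
  rw [← add_assoc, haltProb, if_neg hc, h]

lemma Exec.whileLt_pos (hc : s.reg x < s.reg y) (h : Exec P t s s')
    (h' : Exec (.whileLt x y P) t' s' s'') : Exec (.whileLt x y P) (t + t' + 1) s s'' := by
  intro k n w good f L ρ
  rw [show f + (t + t' + 1) = ((f + t') + t) + 1 by ring, haltProb, if_pos hc, h, h']

lemma Exec.whileLt_neg (hc : ¬ s.reg x < s.reg y) : Exec (.whileLt x y P) 1 s s := by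
  intro k n w good f L ρ
  rw [haltProb, if_neg hc]

/-! ### Forward symbolic execution with step bounds -/

lemma Wp.mono (h : Wp P B s Post) (hB : B ≤ B') (hP : ∀ s', Post s' → Post' s') :
    Wp P B' s Post' := by
  obtain ⟨s', h1, t, h2, h3⟩ := h
  exact ⟨s', hP s' h1, t, h2.trans hB, h3⟩

lemma Wp.nil (h : Post s) : Wp (block []) (B + 1) s Post :=
  ⟨s, h, 1, by omega, Exec.skip⟩

/-- The postcondition of the head is the whole remaining obligation. A proof about a `block` can
therefore walk through it instruction by instruction. -/
lemma Wp.cons (h : Wp P B s fun s' => Wp (block l) B' s' Post) :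
    Wp (block (P :: l)) (B + B' + 1) s Post := by
  obtain ⟨s', ⟨s'', h1, t', h2, h3⟩, t, h4, h5⟩ := h
  exact ⟨s'', h1, t + t' + 1, by omega, h5.seq h3⟩

lemma Wp.cons_exec (h : Exec P 1 s s') (h' : Wp (block l) B s' Post) :
    Wp (block (P :: l)) (B + 2) s Post :=
  (Wp.cons (B := 1) ⟨s', h', 1, le_rfl, h⟩).mono (by omega) fun _ h => h

lemma Wp.const (h : Wp (block l) B (s.setReg x c) Post) :
    Wp (block (.const x c :: l)) (B + 2) s Post := .cons_exec .const h

lemma Wp.add (h : Wp (block l) B (s.setReg x (s.reg y + s.reg z)) Post) :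
    Wp (block (.add x y z :: l)) (B + 2) s Post := .cons_exec .add h

lemma Wp.sub (h : Wp (block l) B (s.setReg x (s.reg y - s.reg z)) Post) :
    Wp (block (.sub x y z :: l)) (B + 2) s Post := .cons_exec .sub h

lemma Wp.load (h : Wp (block l) B (s.setReg x (s.mem (s.reg i) (s.reg j))) Post) :
    Wp (block (.load x i j :: l)) (B + 2) s Post := .cons_exec .load h

lemma Wp.store (h : Wp (block l) B (s.setMem (s.reg i) (s.reg j) (s.reg x)) Post) :
    Wp (block (.store i j x :: l)) (B + 2) s Post := .cons_exec .store h

lemma Wp.ifLt (h : s.reg x < s.reg y → Wp P B s Post) (h' : ¬ s.reg x < s.reg y → Wp R B s Post) :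
    Wp (.ifLt x y P R) (B + 1) s Post := by
  by_cases hc : s.reg x < s.reg y
  · obtain ⟨s', h1, t, h2, h3⟩ := h hc
    exact ⟨s', h1, t + 1, by omega, h3.ifLt_pos hc⟩
  · obtain ⟨s', h1, t, h2, h3⟩ := h' hc
    exact ⟨s', h1, t + 1, by omega, h3.ifLt_neg hc⟩

/-- A loop with invariant `Inv` that is executed exactly `N` times. -/
lemma Wp.whileLt (Inv : ℕ → Store → Prop) (N : ℕ) (h0 : Inv 0 s)
    (step : ∀ i < N, ∀ s, Inv i s → s.reg x < s.reg y ∧ Wp P B s (Inv (i + 1)))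
    (halt : ∀ s, Inv N s → ¬ s.reg x < s.reg y) (post : ∀ s, Inv N s → Post s) :
    Wp (.whileLt x y P) (N * (B + 1) + 1) s Post := by
  -- Induction on the number `d` of remaining iterations, since the loop unfolds at its front.
  have key : ∀ d i, i + d = N → ∀ s, Inv i s → Wp (.whileLt x y P) (d * (B + 1) + 1) s Post := by
    intro d
    induction d with
    | zero =>
      intro i hi s hs
      obtain rfl : i = N := by omega
      exact ⟨s, post s hs, 1, by omega, Exec.whileLt_neg (halt s hs)⟩
    | succ d ih =>
      intro i hi s hs
      obtain ⟨hc, s', hs', t, ht, he⟩ := step i (by omega) s hs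
      obtain ⟨s'', hs'', t', ht', he'⟩ := ih (i + 1) (by omega) s' hs'
      refine ⟨s'', hs'', t + t' + 1, ?_, he.whileLt_pos hc he'⟩
      rw [Nat.succ_mul]
      omega
  exact key N 0 (by omega) s h0

/-- From `(s, ρ)` the program `P` runs for `t` steps and ends in one of the branches
`(S x, R x)`. -/
def Branch {k n w : ℕ} {X : Type} [Fintype X] (P : Prog) (t : ℕ) (s : Store)
    (ρ : Op (Qubits k n w)) (S : X → Store) (R : X → Op (Qubits k n w)) : Prop :=
  ∀ (good : Store → Prop) (f : ℕ) (L : List Prog),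
    haltProb good (f + t) (P :: L) s ρ = ∑ x, haltProb good f L (S x) (R x)

section Branching

variable {k n w : ℕ} {X : Type} [Fintype X] {ρ : Op (Qubits k n w)} {S S' : X → Store}
  {ρs : X → Op (Qubits k n w)}

lemma Branch.cons_exec (h : Exec P t s s') (h' : Branch (block l) t' s' ρ S ρs) :
    Branch (block (P :: l)) (t + t' + 1) s ρ S ρs := by
  intro good f L
  rw [show f + (t + t' + 1) = ((f + t') + t) + 1 by ring, block, haltProb, h, h']

lemma Branch.append_exec (h : Branch P t s ρ S ρs)
    (h' : ∀ x, Exec (block l) t' (S x) (S' x)) :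
    Branch (block (P :: l)) (t + t' + 1) s ρ S' ρs := by
  intro good f L
  rw [show f + (t + t' + 1) = ((f + t') + t) + 1 by ring, block, haltProb, h]
  exact Finset.sum_congr rfl fun x _ => h' x _ _ _ _ _ _ _

/-- A loop with invariant `Inv`, executed exactly `N` times, whose body branches over `X`. -/
lemma Branch.whileLt (Inv : ∀ i, (Fin i → X) → Store → Op (Qubits k n w) → Prop) (N : ℕ)
    (h0 : ∀ ω, Inv 0 ω s ρ)
    (step : ∀ i < N, ∀ ω s ρ, Inv i ω s ρ → s.reg x < s.reg y ∧ ∃ S R, Branch P B s ρ S R ∧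
      ∀ z, Inv (i + 1) (Fin.snoc ω z) (S z) (R z))
    (halt : ∀ ω s ρ, Inv N ω s ρ → ¬ s.reg x < s.reg y) :
    ∃ (S : (Fin N → X) → Store) (R : (Fin N → X) → Op (Qubits k n w)),
      Branch (.whileLt x y P) (N * (B + 1) + 1) s ρ S R ∧ ∀ ω, Inv N ω (S ω) (R ω) := by
  -- After `i` iterations all branches stand in front of the same loop with the same time left. This
  -- is why `Branch` demands one exact step count for all outcomes rather than a bound.
  have key : ∀ i ≤ N, ∃ (S : (Fin i → X) → Store) (R : (Fin i → X) → Op (Qubits k n w)),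
      (∀ good f L, haltProb good (f + i * (B + 1)) (.whileLt x y P :: L) s ρ =
        ∑ ω, haltProb good f (.whileLt x y P :: L) (S ω) (R ω)) ∧
      ∀ ω, Inv i ω (S ω) (R ω) := by
    intro i
    induction i with
    | zero =>
      intro _
      refine ⟨fun _ => s, fun _ => ρ, ?_, h0⟩
      intro good f L
      simp
    | succ i ih =>
      intro hi
      obtain ⟨S, R, hSR, hInv⟩ := ih (by omega)
      have hstep := fun ω => step i (by omega) ω _ _ (hInv ω)
      choose hc S' R' hB hI using hstep
      refine ⟨fun ω => S' (Fin.init ω) (ω (Fin.last i)), fun ω => R' (Fin.init ω) (ω (Fin.last i)),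
        ?_, ?_⟩
      · intro good f L
        rw [show f + (i + 1) * (B + 1) = (f + B + 1) + i * (B + 1) by ring, hSR]
        -- A history of length `i + 1` is a history of length `i` followed by the newest outcome.
        rw [← (Fin.snocEquiv fun _ => X).sum_comp, Fintype.sum_prod_type_right]
        refine Finset.sum_congr rfl fun ω _ => ?_
        rw [haltProb, if_pos (hc ω), hB]
        refine Finset.sum_congr rfl fun z _ => ?_
        simp [Fin.snocEquiv]
      · intro ω
        have := hI (Fin.init ω) (ω (Fin.last i))
        rwa [Fin.snoc_init_self] at this
  obtain ⟨S, R, hSR, hInv⟩ := key N le_rfl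
  refine ⟨S, R, ?_, hInv⟩
  intro good f L
  rw [show f + (N * (B + 1) + 1) = (f + 1) + N * (B + 1) by ring, hSR]
  refine Finset.sum_congr rfl fun ω _ => ?_
  rw [haltProb, if_neg (halt ω _ _ (hInv ω))]

end Branching

end Execution

/-! ### Measurement in random bases -/

/-- The Kraus operator of outcome `m` of a measurement in the computational basis (`r = 0`) or in
the Hadamard basis (`r = 1`). -/
noncomputable def basisKraus (x : ZMod 2 × ZMod 2) : Matrix (ZMod 2) (ZMod 2) ℂ :=
  Matrix.single x.2 x.2 1 * (if x.1 = 1 then gateH else 1)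

/-- Measure qubit `q` of sample `j` in a random basis and record basis and outcome. -/
def measureQubit : Prog := block
  [.add 9 0 5, .hadamard (.work 2), .measure 6 (.work 2),
    .ifLt 2 6 (.hadamard (.sample 4 5)) .skip, .measure 7 (.sample 4 5),
    .store 8 5 6, .store 8 9 7, .add 5 5 3]

/-- The basis choice is itself a measurement, of work qubit 0 after a Hadamard gate. Both arms of
the conditional take one step, so all four branches take exactly 18. Register 6 holds the basis,
register 7 the outcome, register 8 the memory row of the sample, and register 9 the column `n + q`
of the outcome. -/
lemma branch_measureQubit {k n w : ℕ} (s : Store) (j : Fin k) (q : Fin n) (hw : 0 < w)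
    (K : Qubits k n w → Matrix (ZMod 2) (ZMod 2) ℂ) (ρ : Op (Qubits k n w))
    (h2 : s.reg 2 = 0) (h4 : s.reg 4 = j) (h5 : s.reg 5 = q) :
    Branch measureQubit 18 s (conjBy (tens K) ρ)
      (fun x : ZMod 2 × ZMod 2 => (((((s.setReg 9 (s.reg 0 + q)).setReg 6 x.1.val).setReg 7
        x.2.val).setMem (s.reg 8) q x.1.val).setMem (s.reg 8) (s.reg 0 + q) x.2.val).setReg 5
          (q + s.reg 3))
      (fun x => conjBy (tens (Function.update (Function.update K (Sum.inr ⟨0, hw⟩)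
        (Matrix.single x.1 x.1 1 * (gateH * K (Sum.inr ⟨0, hw⟩)))) (Sum.inl (j, q))
          (basisKraus x * K (Sum.inl (j, q))))) ρ) := by
  intro good f L
  have e1 : ∀ s : Store, s.reg 2 = 0 →
      ((QRef.work 2).eval s : Option (Qubits k n w)) = some (Sum.inr ⟨0, hw⟩) := by
    intro s hs
    simp [QRef.eval, hs, hw]
  have e2 : ∀ s : Store, s.reg 4 = j → s.reg 5 = q →
      ((QRef.sample 4 5).eval s : Option (Qubits k n w)) = some (Sum.inl (j, q)) := by
    intro s hs hs'
    simp [QRef.eval, hs, hs']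
  have u : ∀ F : ZMod 2 × ZMod 2 → ℝ, ∑ x, F x = F (0, 0) + F (0, 1) + (F (1, 0) + F (1, 1)) := by
    intro F
    rw [Fintype.sum_prod_type]
    simp only [show (Finset.univ : Finset (ZMod 2)) = {0, 1} from rfl]
    simp
  simp only [measureQubit, block, haltProb, Store.reg_setReg, Store.reg_setMem, h2, h5, collapse,
    conjBy_onQubit_tens, u]
  rw [e1 _ (by simp [Store.reg_setReg, h2])]
  simp [basisKraus, h4, h5, e2, Store.reg_setReg, ZMod.val_one, Matrix.mul_assoc]

/-- All entries of the Hadamard matrix have squared modulus `1/2`, so the coin is fair whichever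
basis state the work qubit was left in. -/
lemma gateH_star_mul_self (a b : ZMod 2) : gateH a b * star (gateH a b) = 1 / 2 := by
  have h : ((Real.sqrt 2 : ℝ) : ℂ) * (Real.sqrt 2 : ℝ) = 2 := by
    rw [← Complex.ofReal_mul, Real.mul_self_sqrt (by norm_num)]; norm_num
  have h' : ((-1 : ℂ) ^ (a.val * b.val)) * (-1) ^ (a.val * b.val) = 1 := by
    rw [← mul_pow]; norm_num
  simp only [gateH, star_mul', star_div₀, star_one, star_pow, star_neg, RCLike.star_def,
    Complex.conj_ofReal]
  rw [mul_mul_mul_comm, h', div_mul_div_comm, h]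
  norm_num

lemma single_mul_apply_zero (b c : ZMod 2) (M : Matrix (ZMod 2) (ZMod 2) ℂ) :
    (Matrix.single b b (1 : ℂ) * M : Matrix _ _ ℂ) c 0 = if c = b then M b 0 else 0 := by
  by_cases h : c = b
  · subst h; simp
  · simp [h]

/-- All work qubits but the first are untouched, and the first one has gone through `N`
preparations and measurements of a random bit. -/
structure WorkReady {k n w : ℕ} (hw : 0 < w) (N : ℕ)
    (K : Qubits k n w → Matrix (ZMod 2) (ZMod 2) ℂ) : Prop where
  support : ∃ b, ∀ c, c ≠ b → K (Sum.inr ⟨0, hw⟩) c 0 = 0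
  gram_eq : gram (K (Sum.inr ⟨0, hw⟩)) 0 0 = (1 / 2) ^ N
  rest : ∀ r, r ≠ ⟨0, hw⟩ → K (Sum.inr r) = 1

/-- The coin qubit needs no reset: after a measurement it is in a basis state, so column 0 of its
Kraus operator has one possibly nonzero entry. The next Hadamard gate and measurement multiply the
probability by exactly `1/2`. -/
lemma WorkReady.randomBit {k n w : ℕ} {hw : 0 < w} {N : ℕ}
    {K : Qubits k n w → Matrix (ZMod 2) (ZMod 2) ℂ} (h : WorkReady hw N K) (b : ZMod 2)
    (a : Fin k × Fin n) (G : Matrix (ZMod 2) (ZMod 2) ℂ) :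
    WorkReady hw (N + 1) (Function.update (Function.update K (Sum.inr ⟨0, hw⟩)
      (Matrix.single b b 1 * (gateH * K (Sum.inr ⟨0, hw⟩)))) (Sum.inl a) G) := by
  obtain ⟨⟨c, hc⟩, hg, hr⟩ := h
  refine ⟨⟨b, ?_⟩, ?_, ?_⟩
  · intro d hd
    simp [hd]
  · have hg' : K (Sum.inr ⟨0, hw⟩) c 0 * star (K (Sum.inr ⟨0, hw⟩) c 0) = (1 / 2) ^ N := by
      rw [← hg, gram, Finset.sum_eq_single c]
      · intro d _ hd; simp [hc d hd]
      · simp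
    simp only [ne_eq, reduceCtorEq, not_false_eq_true, Function.update_of_ne, Function.update_self,
      gram, single_mul_apply_zero]
    rw [Finset.sum_eq_single b (by intro d _ hd; simp [hd]) (by simp), if_pos rfl,
      Matrix.mul_apply, Finset.sum_eq_single c (by intro d _ hd; simp [hc d hd]) (by simp),
      star_mul', mul_mul_mul_comm, gateH_star_mul_self, hg', pow_succ, mul_comm]
  · intro r hr'
    simp [hr', hr r hr']

lemma WorkReady.prod_gram {k n w : ℕ} {hw : 0 < w} {N : ℕ}
    {K : Qubits k n w → Matrix (ZMod 2) (ZMod 2) ℂ} (h : WorkReady hw N K) :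
    ∏ r, gram (K (Sum.inr r)) 0 0 = (1 / 2) ^ N := by
  rw [Finset.prod_eq_single ⟨0, hw⟩ _ (by simp), h.gram_eq]
  intro r _ hr
  rw [h.rest r hr, gram, Finset.sum_eq_single 0]
  · simp
  · intro b _ hb; simp [hb]
  · simp

/-- Measure all qubits of sample number `reg 4`. -/
def measureSample : Prog := block
  [.add 8 0 4, .const 5 0, .whileLt 5 0 measureQubit, .add 4 4 3]

/-- The state of the computation while sample `j` is being measured. -/
structure SampleInv {k n w : ℕ} (hw : 0 < w) (s₀ : Store) (ρ₀ : Op (Qubits k n w))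
    (K₀ : Qubits k n w → Matrix (ZMod 2) (ZMod 2) ℂ) (j : Fin k) (N : ℕ) (i : ℕ)
    (η : Fin i → ZMod 2 × ZMod 2) (s : Store) (ρ : Op (Qubits k n w)) : Prop where
  reg0 : s.reg 0 = n
  reg1 : s.reg 1 = k
  reg2 : s.reg 2 = 0
  reg3 : s.reg 3 = 1
  reg4 : s.reg 4 = j
  reg5 : s.reg 5 = i
  reg8 : s.reg 8 = n + j
  basis : ∀ q : Fin i, s.mem (n + j) q = (η q).1.val
  outcome : ∀ q : Fin i, s.mem (n + j) (n + q) = (η q).2.val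
  frame : ∀ a, a ≠ n + j → s.mem a = s₀.mem a
  state : ∃ K, ρ = conjBy (tens K) ρ₀ ∧ WorkReady hw (N + i) K ∧
    (∀ j' q, j' ≠ j → K (Sum.inl (j', q)) = K₀ (Sum.inl (j', q))) ∧
    (∀ q : Fin n, i ≤ q → K (Sum.inl (j, q)) = 1) ∧
    ∀ (q : Fin n) (h : q < i), K (Sum.inl (j, q)) = basisKraus (η ⟨q, h⟩)

lemma SampleInv.step {k n w : ℕ} {hw : 0 < w} {s₀ : Store} {ρ₀ : Op (Qubits k n w)}
    {K₀ : Qubits k n w → Matrix (ZMod 2) (ZMod 2) ℂ} {j : Fin k} {N : ℕ} {i : ℕ} (hi : i < n)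
    {η : Fin i → ZMod 2 × ZMod 2} {s : Store} {ρ : Op (Qubits k n w)}
    (h : SampleInv hw s₀ ρ₀ K₀ j N i η s ρ) :
    ∃ S R, Branch measureQubit 18 s ρ S R ∧
      ∀ z, SampleInv hw s₀ ρ₀ K₀ j N (i + 1) (Fin.snoc η z) (S z) (R z) := by
  obtain ⟨h0, h1, h2, h3, h4, h5, h8, hb, ho, hf, K, rfl, hW, hK1, hK2, hK3⟩ := h
  refine ⟨_, _, branch_measureQubit s j ⟨i, hi⟩ hw K ρ₀ h2 h4 h5, fun z => ?_⟩
  constructor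
  case state =>
    refine ⟨_, rfl, hW.randomBit z.1 _ _, ?_, ?_, ?_⟩
    · intro j' q hj
      rw [Function.update_of_ne (by simp [hj]), Function.update_of_ne (by simp), hK1 j' q hj]
    · intro q hq
      rw [Function.update_of_ne, Function.update_of_ne (by simp), hK2 q (by omega)]
      simp only [ne_eq, Sum.inl.injEq, Prod.mk.injEq, true_and, Fin.ext_iff]
      omega
    · intro q hq
      by_cases hqi : (q : ℕ) = i
      · obtain rfl : q = ⟨i, hi⟩ := Fin.ext hqi
        rw [Function.update_self, hK2 _ le_rfl, mul_one]
        congr 1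
        exact (Fin.snoc_last (α := fun _ => ZMod 2 × ZMod 2) z η).symm
      · have hlt : (q : ℕ) < i := by omega
        rw [Function.update_of_ne, Function.update_of_ne (by simp), hK3 q hlt]
        · congr 1
          exact (Fin.snoc_castSucc (α := fun _ => ZMod 2 × ZMod 2) z η ⟨q, hlt⟩).symm
        · simp only [ne_eq, Sum.inl.injEq, Prod.mk.injEq, true_and, Fin.ext_iff]
          omega
  case basis =>
    intro q
    refine Fin.lastCases ?_ (fun q => ?_) q
    -- Needed so that the later write to column `n + i` does not overwrite the basis in column `i`.
    · have : n ≠ 0 := by omega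
      simp [Store.mem_setReg, Store.mem_setMem, h0, h8, this]
    · have h6 : (q : ℕ) ≠ i := by have := q.2; omega
      have h7 : (q : ℕ) ≠ n + i := by have := q.2; omega
      simp [Store.mem_setReg, Store.mem_setMem, h0, h8, h6, h7, hb]
  case outcome =>
    intro q
    refine Fin.lastCases ?_ (fun q => ?_) q
    · simp [Store.mem_setReg, Store.mem_setMem, h0, h8]
    · have h6 : (q : ℕ) ≠ i := by have := q.2; omega
      have h7 : n + (q : ℕ) ≠ i := by omega
      simp [Store.mem_setReg, Store.mem_setMem, h0, h8, h6, h7, ho]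
  case frame =>
    intro a ha
    rw [← hf a ha]
    ext b
    simp [Store.mem_setReg, Store.mem_setMem, h8, ha]
  all_goals simp [Store.reg_setReg, Store.reg_setMem, *]

/-- The state of the computation after the first `j` samples have been measured. -/
structure MeasureInv {k n w : ℕ} (hw : 0 < w) (ρ₀ : Op (Qubits k n w)) (j : ℕ)
    (ω : Fin j → Fin n → ZMod 2 × ZMod 2) (s : Store) (ρ : Op (Qubits k n w)) : Prop where
  reg0 : s.reg 0 = n
  reg1 : s.reg 1 = k
  reg2 : s.reg 2 = 0
  reg3 : s.reg 3 = 1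
  reg4 : s.reg 4 = j
  basis : ∀ (i : Fin j) (q : Fin n), s.mem (n + i) q = (ω i q).1.val
  outcome : ∀ (i : Fin j) (q : Fin n), s.mem (n + i) (n + q) = (ω i q).2.val
  frame : ∀ a b, a < n ∨ n + j ≤ a → s.mem a b = 0
  state : ∃ K, ρ = conjBy (tens K) ρ₀ ∧ WorkReady hw (j * n) K ∧
    (∀ (i : Fin k) (q : Fin n), j ≤ i → K (Sum.inl (i, q)) = 1) ∧
    ∀ (i : Fin k) (q : Fin n) (h : i < j), K (Sum.inl (i, q)) = basisKraus (ω ⟨i, h⟩ q)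

lemma MeasureInv.step {k n w : ℕ} {hw : 0 < w} {ρ₀ : Op (Qubits k n w)} {j : ℕ} (hj : j < k)
    {ω : Fin j → Fin n → ZMod 2 × ZMod 2} {s : Store} {ρ : Op (Qubits k n w)}
    (h : MeasureInv hw ρ₀ j ω s ρ) :
    ∃ S R, Branch measureSample (n * (18 + 1) + 9) s ρ S R ∧
      ∀ z, MeasureInv hw ρ₀ (j + 1) (Fin.snoc ω z) (S z) (R z) := by
  obtain ⟨h0, h1, h2, h3, h4, hb, ho, hf, K, rfl, hW, hK1, hK2⟩ := h
  set s1 : Store := (s.setReg 8 (s.reg 0 + s.reg 4)).setReg 5 0 with hs1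
  obtain ⟨S, R, hB, hI⟩ := Branch.whileLt (P := measureQubit) (B := 18) (x := 5) (y := 0) (s := s1)
    (ρ := conjBy (tens K) ρ₀) (SampleInv hw s ρ₀ K ⟨j, hj⟩ (j * n)) n
    (by
      intro η
      constructor
      case state => exact ⟨K, rfl, hW, fun _ _ _ => rfl, fun q _ => hK1 _ _ le_rfl,
          fun q h => absurd h (by omega)⟩
      case basis => exact fun q => q.elim0
      case outcome => exact fun q => q.elim0
      all_goals simp [s1, Store.reg_setReg, Store.mem_setReg, *])
    (fun i hi η s' ρ' h => ⟨by rw [h.reg5, h.reg0]; exact hi, h.step hi⟩)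
    (fun η s' ρ' h => by rw [h.reg5, h.reg0]; exact lt_irrefl _)
  refine ⟨fun z => (S z).setReg 4 ((S z).reg 4 + (S z).reg 3), R, ?_, fun z => ?_⟩
  · have := Branch.cons_exec (s := s) Exec.add (Branch.cons_exec Exec.const
      (Branch.append_exec (l := [.add 4 4 3]) hB fun x => (Exec.add (x := 4) (y := 4) (z := 3)).seq Exec.skip))
    -- The count is exact, as `Branch` requires: two assignments, the loop, the increment of the
    -- sample number, and the overhead of the sequential composition.
    rw [show n * (18 + 1) + 9 = 1 + (1 + (n * (18 + 1) + 1 + (1 + 1 + 1) + 1) + 1) + 1 by ring]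
    exact this
  obtain ⟨g0, g1, g2, g3, g4, g5, g8, gb, go, gf, K', hK', gW, gK1, gK2, gK3⟩ := hI z
  constructor
  case state =>
    refine ⟨K', hK', by rwa [Nat.succ_mul], ?_, ?_⟩
    · intro i q hi
      rw [gK1 _ _ (by rw [ne_eq, Fin.ext_iff]; simp only; omega), hK1 _ _ (by omega)]
    · intro i q hi
      by_cases hij : (i : ℕ) = j
      · obtain rfl : i = ⟨j, hj⟩ := Fin.ext hij
        rw [gK3 q q.2]
        congr 1
        exact congrFun (Fin.snoc_last (α := fun _ => Fin n → ZMod 2 × ZMod 2) z ω).symm q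
      · have hlt : (i : ℕ) < j := by omega
        rw [gK1 _ _ (by rw [ne_eq, Fin.ext_iff]; exact hij), hK2 i q hlt]
        congr 1
        exact congrFun
          (Fin.snoc_castSucc (α := fun _ => Fin n → ZMod 2 × ZMod 2) z ω ⟨i, hlt⟩).symm q
  case basis =>
    intro i q
    refine Fin.lastCases ?_ (fun i => ?_) i
    · simpa [Store.mem_setReg] using gb q
    · simp only [Store.mem_setReg, Fin.snoc_castSucc, Fin.val_castSucc]
      rw [gf _ (by have := i.2; simp only; omega), hb]
  case outcome =>
    intro i q
    refine Fin.lastCases ?_ (fun i => ?_) i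
    · simpa [Store.mem_setReg] using go q
    · simp only [Store.mem_setReg, Fin.snoc_castSucc, Fin.val_castSucc]
      rw [gf _ (by have := i.2; simp only; omega), ho]
  case frame =>
    intro a b hab
    rw [Store.mem_setReg, gf _ (by simp only; omega), hf a b (by omega)]
  all_goals simp [Store.reg_setReg, *]

/-- Measure all qubits of all samples. -/
def measureAll : Prog := .whileLt 4 1 measureSample

lemma branch_measureAll {k n w : ℕ} (hw : 0 < w) (ρ₀ : Op (Qubits k n w)) :
    ∃ (S : (Fin k → Fin n → ZMod 2 × ZMod 2) → Store) (R : _ → Op (Qubits k n w)),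
      Branch measureAll (k * (n * (18 + 1) + 9 + 1) + 1) ((initStore n k).setReg 3 1) ρ₀ S R ∧
      ∀ ω, MeasureInv hw ρ₀ k ω (S ω) (R ω) := by
  refine Branch.whileLt (P := measureSample) (MeasureInv hw ρ₀) k ?_
    (fun i hi η s' ρ' h => ⟨by rw [h.reg4, h.reg1]; exact hi, h.step hi⟩)
    (fun η s' ρ' h => by rw [h.reg4, h.reg1]; exact lt_irrefl _)
  intro ω
  constructor
  case state =>
    refine ⟨fun _ => 1, (conjBy_tens_one ρ₀).symm, ⟨⟨0, ?_⟩, ?_, ?_⟩, by simp, by simp⟩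
    · intro c hc
      simp [hc]
    · rw [gram, Finset.sum_eq_single 0]
      · simp
      · intro b _ hb; simp [hb]
      · simp
    · simp
  case basis => exact fun q => q.elim0
  case outcome => exact fun q => q.elim0
  all_goals simp [initStore, Store.reg_setReg, Store.mem_setReg]

/-! ### The classical post-processing -/

lemma Wp.cons_le {P : Prog} {l : List Prog} {B B' B'' : ℕ} {s : Store} {Post : Store → Prop}
    (hB : B + B' + 1 ≤ B'') (h : Wp P B s fun s' => Wp (block l) B' s' Post) :
    Wp (block (P :: l)) B'' s Post := (Wp.cons h).mono hB fun _ h => h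

/-- The registers outside `l` have the same contents in both stores. -/
def Frame (l : List ℕ) (s s' : Store) : Prop := ∀ x ∉ l, s'.reg x = s.reg x

/-! #### The size of the table -/

/-- Write `2 ^ (⌈√n⌉)` to register 10. -/
def powSqrt : Prog := block
  [.const 10 1, .const 11 0, .const 12 1, .const 13 2,
    .whileLt 11 0 (block [.add 10 10 10, .add 11 11 12, .add 12 12 13])]

/-- The number of rows of the table. -/
def tableSize (n : ℕ) : ℕ := 2 ^ (Nat.sqrt (n - 1) + 1)

/-- Without multiplication, the square in register 11 is advanced by adding the odd numbers held in
register 12. The loop stops at the first `i` with `n ≤ i * i`, which is `Nat.sqrt (n - 1) + 1`;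
meanwhile register 10 is doubled once per round. -/
lemma wp_powSqrt {n : ℕ} (hn : 0 < n) (s : Store) (h0 : s.reg 0 = n) :
    Wp powSqrt ((Nat.sqrt (n - 1) + 1) * 11 + 20) s fun s' =>
      s'.reg 10 = tableSize n ∧ Frame [10, 11, 12, 13] s s' ∧ s'.mem = s.mem := by
  refine Wp.const <| Wp.const <| Wp.const <| Wp.const ?_
  refine Wp.cons_le (B := (Nat.sqrt (n - 1) + 1) * (10 + 1) + 1) (B' := 1) (by omega) ?_
  refine Wp.whileLt (fun i s' => s'.reg 10 = 2 ^ i ∧ s'.reg 11 = i * i ∧ s'.reg 12 = 2 * i + 1 ∧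
    s'.reg 13 = 2 ∧ Frame [10, 11, 12, 13] s s' ∧ s'.mem = s.mem) _ ?_ ?_ ?_ ?_
  · simp +contextual [Store.reg_setReg, Store.mem_setReg, Frame]
  · rintro i hi s' ⟨g10, g11, g12, g13, gF, gm⟩
    have g0 : s'.reg 0 = n := by rw [gF 0 (by decide), h0]
    refine ⟨?_, ?_⟩
    · rw [g11, g0]
      have h1 : i ≤ Nat.sqrt (n - 1) := by omega
      have h2 := Nat.le_sqrt.mp h1
      omega
    · refine Wp.add <| Wp.add <| Wp.add <| Wp.nil ?_
      refine ⟨?_, ?_, ?_, ?_, ?_, ?_⟩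
      · simp [Store.reg_setReg, g10]; ring
      · simp [Store.reg_setReg, g11, g12]; ring
      · simp [Store.reg_setReg, g12, g13]; ring
      · simp [Store.reg_setReg, g13]
      · intro x hx
        rw [← gF x hx]
        simp at hx
        simp [Store.reg_setReg, hx]
      · simpa [Store.mem_setReg] using gm
  · rintro s' ⟨g10, g11, g12, g13, gF, gm⟩
    have g0 : s'.reg 0 = n := by rw [gF 0 (by decide), h0]
    rw [g11, g0]
    have h2 := Nat.sqrt_lt.mp (Nat.lt_succ_self (Nat.sqrt (n - 1)))
    simp only [Nat.succ_eq_add_one] at h2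
    omega
  · rintro s' ⟨g10, g11, g12, g13, gF, gm⟩
    exact Wp.nil ⟨g10, gF, gm⟩

/-! #### The table of candidates -/

/-- The rows of the table: row `t + 1` is obtained from row `t / n` by flipping entry `t % n`. -/
def rowVec (n : ℕ) : ℕ → ℕ → ZMod 2
  | 0 => 0
  | t + 1 => rowVec n (t / n) + Pi.single (t % n) 1
  decreasing_by exact Nat.lt_succ_of_le (Nat.div_le_self t n)

/-- Append a row to the table. -/
def tableStep : Prog := block
  [.add 15 15 3, .const 5 0, .whileLt 5 0 (block [.load 6 16 5, .store 15 5 6, .add 5 5 3]),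
    .load 6 15 18, .sub 6 3 6, .store 15 18 6, .add 18 18 3,
    .ifLt 18 0 (block []) (block [.const 18 0, .add 16 16 3])]

/-- Write the table to the memory, starting at row `n + k`. -/
def buildTable : Prog := block
  [.add 14 0 1, .add 15 14 2, .add 16 14 2, .add 17 14 10, .const 18 0, .whileLt 15 17 tableStep]

lemma val_one_sub (v : ZMod 2) : 1 - v.val = (v + 1).val := by
  revert v; decide

/-- The first `t + 1` rows of the table have been written. -/
structure TableInv (n k M : ℕ) (s₀ : Store) (t : ℕ) (s : Store) : Prop where
  reg0 : s.reg 0 = n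
  reg2 : s.reg 2 = 0
  reg3 : s.reg 3 = 1
  reg14 : s.reg 14 = n + k
  reg15 : s.reg 15 = n + k + t
  reg16 : s.reg 16 = n + k + t / n
  reg17 : s.reg 17 = n + k + M
  reg18 : s.reg 18 = t % n
  rows : ∀ u ≤ t, ∀ q < n, s.mem (n + k + u) q = (rowVec n u q).val
  frame : ∀ a < n + k, s.mem a = s₀.mem a

lemma wp_copyRow {n : ℕ} (s : Store) {src dst : ℕ} (hne : src ≠ dst) (h0 : s.reg 0 = n)
    (h3 : s.reg 3 = 1) (h5 : s.reg 5 = 0) (h15 : s.reg 15 = dst) (h16 : s.reg 16 = src) :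
    Wp (.whileLt 5 0 (block [.load 6 16 5, .store 15 5 6, .add 5 5 3])) (n * (10 + 1) + 1) s
      fun s' => Frame [5, 6] s s' ∧ (∀ q < n, s'.mem dst q = s.mem src q) ∧
        ∀ a, a ≠ dst → s'.mem a = s.mem a := by
  refine Wp.whileLt (fun i s' => s'.reg 5 = i ∧ Frame [5, 6] s s' ∧
    (∀ q < i, s'.mem dst q = s.mem src q) ∧ ∀ a, a ≠ dst → s'.mem a = s.mem a) n ?_ ?_ ?_ ?_
  · exact ⟨h5, fun _ _ => rfl, by simp, by simp⟩
  · rintro i hi s' ⟨g5, gF, gd, gm⟩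
    refine ⟨by rw [g5, gF 0 (by decide), h0]; exact hi, ?_⟩
    refine Wp.load <| Wp.store <| Wp.add <| Wp.nil ?_
    have g15 := (gF 15 (by decide)).trans h15
    have g16 := (gF 16 (by decide)).trans h16
    have g3 := (gF 3 (by decide)).trans h3
    refine ⟨by simp [Store.reg_setReg, Store.reg_setMem, g5, g3], ?_, ?_, ?_⟩
    · intro x hx
      rw [← gF x hx]
      simp at hx
      simp [Store.reg_setReg, Store.reg_setMem, hx]
    · intro q hq
      simp only [Store.mem_setReg, Store.mem_setMem, Store.reg_setReg, g15, g5, g16]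
      by_cases hqi : q = i
      · simp [hqi, gm src hne]
      · simpa [hqi] using gd q (by omega)
    · intro a ha
      rw [← gm a ha]
      ext b
      simp [Store.mem_setReg, Store.mem_setMem, Store.reg_setReg, g15, ha]
  · rintro s' ⟨g5, gF, gd, gm⟩
    rw [g5, gF 0 (by decide), h0]
    exact lt_irrefl _
  · rintro s' ⟨g5, gF, gd, gm⟩
    exact ⟨gF, gd, gm⟩

/-- Registers 16 and 18 form a counter with carry for the address of row `t / n` and for `t % n`,
which replaces division. The source row is already written because `t / n ≤ t`. -/
lemma TableInv.step {n k M : ℕ} (hn : 0 < n) {s₀ s : Store} {t : ℕ}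
    (h : TableInv n k M s₀ t s) :
    Wp tableStep (n * (10 + 1) + 30) s (TableInv n k M s₀ (t + 1)) := by
  obtain ⟨h0, h2, h3, h14, h15, h16, h17, h18, hr, hf⟩ := h
  refine Wp.add <| Wp.const <| Wp.cons_le (B := n * (10 + 1) + 1) (B' := 24) (by omega) ?_
  have hdiv : t / n ≤ t := Nat.div_le_self t n
  refine (wp_copyRow (n := n) (src := n + k + t / n) (dst := n + k + t + 1) _ (by omega)
    ?_ ?_ ?_ ?_ ?_).mono le_rfl ?_
  iterate 5 simp [Store.reg_setReg, *]
  rintro s' ⟨gF, gd, gm⟩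
  simp only [Store.mem_setReg] at gd gm
  have g0 : s'.reg 0 = n := by rw [gF 0 (by decide)]; simpa [Store.reg_setReg] using h0
  have g2 : s'.reg 2 = 0 := by rw [gF 2 (by decide)]; simpa [Store.reg_setReg] using h2
  have g3 : s'.reg 3 = 1 := by rw [gF 3 (by decide)]; simpa [Store.reg_setReg] using h3
  have g14 : s'.reg 14 = n + k := by rw [gF 14 (by decide)]; simpa [Store.reg_setReg] using h14
  have g15 : s'.reg 15 = n + k + t + 1 := by
    rw [gF 15 (by decide)]; simp [Store.reg_setReg, h15, h3]
  have g16 : s'.reg 16 = n + k + t / n := by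
    rw [gF 16 (by decide)]; simpa [Store.reg_setReg] using h16
  have g17 : s'.reg 17 = n + k + M := by
    rw [gF 17 (by decide)]; simpa [Store.reg_setReg] using h17
  have g18 : s'.reg 18 = t % n := by
    rw [gF 18 (by decide)]; simpa [Store.reg_setReg] using h18
  have hlt : t % n < n := Nat.mod_lt t hn
  refine Wp.load <| Wp.sub <| Wp.store <| Wp.add ?_
  set s1 : Store := ((((s'.setReg 6 (s'.mem (s'.reg 15) (s'.reg 18))).setReg 6 _).setMem _ _
    _).setReg 18 _) with hs1
  have hrows : ∀ u ≤ t + 1, ∀ q < n, s1.mem (n + k + u) q = (rowVec n u q).val := by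
    intro u hu q hq
    simp only [hs1, Store.mem_setReg, Store.mem_setMem, Store.reg_setReg, g15, g18, g3]
    by_cases hut : u = t + 1
    · subst hut
      rw [rowVec, Pi.add_apply]
      by_cases hqt : q = t % n
      · subst hqt
        have := gd (t % n) hlt
        rw [hr _ hdiv _ hlt] at this
        simp [← add_assoc, this, val_one_sub]
      · have := gd q hq
        rw [hr _ hdiv _ hq] at this
        simp [hqt, ← add_assoc, this]
    · have hne : n + k + u ≠ n + k + t + 1 := by omega
      rw [if_neg (by simp [hne]), gm _ hne, hr u (by omega) q hq]
  have hframe : ∀ a < n + k, s1.mem a = s₀.mem a := by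
    intro a ha
    rw [← hf a ha, ← gm a (by omega)]
    ext b
    have hne : a ≠ n + k + t + 1 := by omega
    simp [hs1, Store.mem_setReg, Store.mem_setMem, Store.reg_setReg, g15, hne]
  have e18 : s1.reg 18 = t % n + 1 := by
    simp [hs1, Store.reg_setReg, Store.reg_setMem, g18, g3]
  have e0 : s1.reg 0 = n := by simp [hs1, Store.reg_setReg, Store.reg_setMem, g0]
  have e2 : s1.reg 2 = 0 := by simp [hs1, Store.reg_setReg, Store.reg_setMem, g2]
  have e3 : s1.reg 3 = 1 := by simp [hs1, Store.reg_setReg, Store.reg_setMem, g3]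
  have e14 : s1.reg 14 = n + k := by simp [hs1, Store.reg_setReg, Store.reg_setMem, g14]
  have e15 : s1.reg 15 = n + k + t + 1 := by simp [hs1, Store.reg_setReg, Store.reg_setMem, g15]
  have e16 : s1.reg 16 = n + k + t / n := by simp [hs1, Store.reg_setReg, Store.reg_setMem, g16]
  have e17 : s1.reg 17 = n + k + M := by simp [hs1, Store.reg_setReg, Store.reg_setMem, g17]
  clear hs1
  clear_value s1
  have hdm := Nat.div_add_mod t n
  refine Wp.cons_le (B := 10) (B' := 1) (by omega) (Wp.ifLt (fun hc => ?_) fun hc => ?_)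
  · rw [e18, e0] at hc
    have hq : (t + 1) / n = t / n ∧ (t + 1) % n = t % n + 1 :=
      (Nat.div_mod_unique hn).mpr ⟨by omega, hc⟩
    refine Wp.nil <| Wp.nil ?_
    exact ⟨e0, e2, e3, e14, by rw [e15]; ring, by rw [e16, hq.1], e17, by rw [e18, hq.2], hrows,
      hframe⟩
  · rw [e18, e0] at hc
    have hq : (t + 1) / n = t / n + 1 ∧ (t + 1) % n = 0 :=
      (Nat.div_mod_unique hn).mpr ⟨by rw [Nat.mul_add, Nat.mul_one]; omega, hn⟩
    refine Wp.const <| Wp.add <| Wp.nil <| Wp.nil ?_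
    constructor
    case rows => simpa [Store.mem_setReg] using hrows
    case frame => simpa [Store.mem_setReg] using hframe
    case reg15 => simp [Store.reg_setReg, e15, add_assoc]
    case reg16 => simp [Store.reg_setReg, e16, e3, hq.1, add_assoc]
    all_goals simp [Store.reg_setReg, *]

lemma wp_buildTable {n k M : ℕ} (hn : 0 < n) (s : Store) (h0 : s.reg 0 = n) (h1 : s.reg 1 = k)
    (h2 : s.reg 2 = 0) (h3 : s.reg 3 = 1) (h10 : s.reg 10 = M)
    (hz : ∀ q < n, s.mem (n + k) q = 0) :
    Wp buildTable (M * (n * (10 + 1) + 30 + 1) + 13) s (TableInv n k M s M) := by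
  refine Wp.add <| Wp.add <| Wp.add <| Wp.add <| Wp.const ?_
  refine Wp.cons_le (B := M * (n * (10 + 1) + 30 + 1) + 1) (B' := 1) le_rfl ?_
  refine Wp.whileLt (TableInv n k M s) M ?_ ?_ ?_ ?_
  · constructor
    case rows =>
      intro u hu q hq
      -- Row 0 of the table is the zero vector, which the untouched memory already contains.
      obtain rfl : u = 0 := by omega
      simpa [Store.mem_setReg, rowVec] using hz q hq
    all_goals simp [Store.reg_setReg, Store.mem_setReg, *]
  · intro i hi s' h
    exact ⟨by rw [h.reg15, h.reg17]; omega, h.step hn⟩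
  · intro s' h
    rw [h.reg15, h.reg17]
    exact lt_irrefl _
  · intro s' h
    exact Wp.nil h

/-! #### Scores -/

/-- Within the first `p` qubits, the bases `r` are suited to test candidate `c` for row `i`. -/
def Suited (r c : ℕ → ZMod 2) (i p : ℕ) : Prop := r i = 1 ∧ ∀ q < p, c q = 1 → r q = 0

/-- The parity of the outcomes `m` that candidate `c` for row `i` predicts to be constant. -/
def testParity (m c : ℕ → ZMod 2) (i p : ℕ) : ZMod 2 := m i + ∑ q ∈ Finset.range p, c q * m q

open Classical in
/-- The number of samples among the first `j` that are suited to test candidate `c` for row `i` and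
have parity `v`. -/
noncomputable def votes (r m : ℕ → ℕ → ZMod 2) (c : ℕ → ZMod 2) (i n : ℕ) (v : ZMod 2) (j : ℕ) :
    ℕ := ∑ l ∈ Finset.range j, if Suited (r l) c i n ∧ testParity (m l) c i n = v then 1 else 0

open Classical in
lemma votes_succ (r m : ℕ → ℕ → ZMod 2) (c : ℕ → ZMod 2) (i n : ℕ) (v : ZMod 2) (j : ℕ) :
    votes r m c i n v (j + 1) = votes r m c i n v j +
      if Suited (r j) c i n ∧ testParity (m j) c i n = v then 1 else 0 :=
  Finset.sum_range_succ _ _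

/-- Update validity and parity by one qubit. -/
def scanStep : Prog := block
  [.load 6 15 5,
    .ifLt 2 6 (block
      [.load 7 8 5, .ifLt 2 7 (block [.const 26 0]) (block []),
        .add 9 0 5, .load 7 8 9, .ifLt 2 7 (block [.sub 27 3 27]) (block [])]) (block []),
    .add 5 5 3]

/-- The context of the evaluation: the measured data and the table of candidates are in the
memory. -/
structure Ready (n k M : ℕ) (r m c : ℕ → ℕ → ZMod 2) (s : Store) : Prop where
  reg0 : s.reg 0 = n
  reg2 : s.reg 2 = 0
  reg3 : s.reg 3 = 1
  reg14 : s.reg 14 = n + k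
  reg17 : s.reg 17 = n + k + M
  basis : ∀ j < k, ∀ q < n, s.mem (n + j) q = (r j q).val
  outcome : ∀ j < k, ∀ q < n, s.mem (n + j) (n + q) = (m j q).val
  rows : ∀ t < M, ∀ q < n, s.mem (n + k + t) q = (c t q).val

lemma Ready.of_eq {n k M : ℕ} {r m c : ℕ → ℕ → ZMod 2} {s s' : Store} (h : Ready n k M r m c s)
    (h0 : s'.reg 0 = s.reg 0) (h2 : s'.reg 2 = s.reg 2) (h3 : s'.reg 3 = s.reg 3)
    (h14 : s'.reg 14 = s.reg 14) (h17 : s'.reg 17 = s.reg 17)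
    (hm : ∀ a, n ≤ a → s'.mem a = s.mem a) : Ready n k M r m c s' := by
  obtain ⟨g0, g2, g3, g14, g17, gb, go, gr⟩ := h
  refine ⟨h0.trans g0, h2.trans g2, h3.trans g3, h14.trans g14, h17.trans g17, ?_, ?_, ?_⟩
  · intro j hj q hq
    rw [hm _ (by omega), gb j hj q hq]
  · intro j hj q hq
    rw [hm _ (by omega), go j hj q hq]
  · intro j hj q hq
    rw [hm _ (by omega), gr j hj q hq]

lemma Ready.of_frame {n k M : ℕ} {r m c : ℕ → ℕ → ZMod 2} {s s' : Store} {l : List ℕ}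
    (h : Ready n k M r m c s) (hF : Frame l s s') (hm : s'.mem = s.mem)
    (hl : 0 ∉ l ∧ 2 ∉ l ∧ 3 ∉ l ∧ 14 ∉ l ∧ 17 ∉ l) : Ready n k M r m c s' :=
  h.of_eq (hF 0 hl.1) (hF 2 hl.2.1) (hF 3 hl.2.2.1) (hF 14 hl.2.2.2.1) (hF 17 hl.2.2.2.2)
    fun _ _ => by rw [hm]

lemma ZMod.two_cases (v : ZMod 2) : v = 0 ∨ v = 1 := by
  revert v; decide

/-- Suitability can be updated one qubit at a time, which is what register 26 does during the scan;
register 27 does the same for the parity. -/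
lemma suited_succ (r c : ℕ → ZMod 2) (i p : ℕ) :
    Suited r c i (p + 1) ↔ Suited r c i p ∧ (c p = 1 → r p = 0) := by
  simp only [Suited, Nat.lt_succ_iff_lt_or_eq]
  constructor
  · rintro ⟨h1, h2⟩
    exact ⟨⟨h1, fun q hq => h2 q (Or.inl hq)⟩, h2 p (Or.inr rfl)⟩
  · rintro ⟨⟨h1, h2⟩, h3⟩
    refine ⟨h1, ?_⟩
    rintro q (hq | rfl)
    · exact h2 q hq
    · exact h3

lemma testParity_succ (m c : ℕ → ZMod 2) (i p : ℕ) :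
    testParity m c i (p + 1) = testParity m c i p + c p * m p := by
  simp only [testParity, Finset.sum_range_succ]
  ring

open Classical in
/-- Invariant of the scan of one sample. -/
structure ScanInv (n : ℕ) (r m c : ℕ → ZMod 2) (i : ℕ) (s₀ : Store) (p : ℕ) (s : Store) :
    Prop where
  reg5 : s.reg 5 = p
  reg26 : s.reg 26 = if Suited r c i p then 1 else 0
  reg27 : s.reg 27 = (testParity m c i p).val
  frame : Frame [5, 6, 7, 9, 26, 27] s₀ s
  mem : s.mem = s₀.mem

lemma ScanInv.step {n : ℕ} {r m c : ℕ → ZMod 2} {i p a b : ℕ} {s₀ s : Store} (hp : p < n)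
    (h : ScanInv n r m c i s₀ p s) (h0 : s₀.reg 0 = n) (h2 : s₀.reg 2 = 0) (h3 : s₀.reg 3 = 1)
    (h8 : s₀.reg 8 = a) (h15 : s₀.reg 15 = b) (hr : ∀ q < n, s₀.mem a q = (r q).val)
    (hm : ∀ q < n, s₀.mem a (n + q) = (m q).val) (hc : ∀ q < n, s₀.mem b q = (c q).val) :
    Wp scanStep 30 s (ScanInv n r m c i s₀ (p + 1)) := by
  classical
  obtain ⟨h5, h26, h27, hF, hM⟩ := h
  have g0 := (hF 0 (by decide)).trans h0
  have g2 := (hF 2 (by decide)).trans h2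
  have g3 := (hF 3 (by decide)).trans h3
  have g8 := (hF 8 (by decide)).trans h8
  have g15 := (hF 15 (by decide)).trans h15
  have hrp := hr p hp
  have hmp := hm p hp
  have hcp := hc p hp
  rw [← hM] at hrp hmp hcp
  have fr : ∀ {s'}, (∀ x ∉ [5, 6, 7, 9, 26, 27], s'.reg x = s.reg x) →
      Frame [5, 6, 7, 9, 26, 27] s₀ s' := fun h x hx => (h x hx).trans (hF x hx)
  refine Wp.load <| Wp.cons_le (B := 19) (B' := 8) (by norm_num) <| Wp.ifLt (fun hc1 => ?_)
    fun hc1 => ?_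
  · have hc1' : c p = 1 := by
      rcases ZMod.two_cases (c p) with h | h
      · simp [Store.reg_setReg, g2, g15, h5, hcp, h] at hc1
      · exact h
    refine Wp.load <| Wp.cons_le (B := 4) (B' := 11) (by norm_num) <| Wp.ifLt (fun hc2 => ?_)
      fun hc2 => ?_
    · have hr1 : r p = 1 := by
        rcases ZMod.two_cases (r p) with h | h
        · simp [Store.reg_setReg, Store.mem_setReg, g2, g8, h5, hrp, h] at hc2
        · exact h
      refine Wp.const <| Wp.nil <| Wp.add <| Wp.load <| Wp.cons_le (B := 4) (B' := 2) (by norm_num)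
        <| Wp.ifLt (fun hc3 => ?_) fun hc3 => ?_
      · have hm1 : m p = 1 := by
          rcases ZMod.two_cases (m p) with h | h
          · simp [Store.reg_setReg, Store.mem_setReg, g2, g8, g0, h5, hmp, h] at hc3
          · exact h
        refine Wp.sub <| Wp.nil <| Wp.nil <| Wp.add <| Wp.nil ?_
        refine ⟨by simp [Store.reg_setReg, h5, g3], ?_, ?_, fr ?_, by simpa [Store.mem_setReg]⟩
        · simp [Store.reg_setReg, suited_succ, hc1', hr1]
        · simp [Store.reg_setReg, testParity_succ, hc1', hm1, h27, g3, val_one_sub]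
        · intro x hx
          simp at hx
          simp [Store.reg_setReg, hx]
      · have hm1 : m p = 0 := by
          rcases ZMod.two_cases (m p) with h | h
          · exact h
          · simp [Store.reg_setReg, Store.mem_setReg, g2, g8, g0, h5, hmp, h, ZMod.val_one] at hc3
        refine Wp.nil <| Wp.nil <| Wp.add <| Wp.nil ?_
        refine ⟨by simp [Store.reg_setReg, h5, g3], ?_, ?_, fr ?_, by simpa [Store.mem_setReg]⟩
        · simp [Store.reg_setReg, suited_succ, hc1', hr1]
        · simp [Store.reg_setReg, testParity_succ, hc1', hm1, h27]
        · intro x hx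
          simp at hx
          simp [Store.reg_setReg, hx]
    · have hr1 : r p = 0 := by
        rcases ZMod.two_cases (r p) with h | h
        · exact h
        · simp [Store.reg_setReg, Store.mem_setReg, g2, g8, h5, hrp, h, ZMod.val_one] at hc2
      refine Wp.nil <| Wp.add <| Wp.load <| Wp.cons_le (B := 4) (B' := 2) (by norm_num)
        <| Wp.ifLt (fun hc3 => ?_) fun hc3 => ?_
      · have hm1 : m p = 1 := by
          rcases ZMod.two_cases (m p) with h | h
          · simp [Store.reg_setReg, Store.mem_setReg, g2, g8, g0, h5, hmp, h] at hc3
          · exact h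
        refine Wp.sub <| Wp.nil <| Wp.nil <| Wp.add <| Wp.nil ?_
        refine ⟨by simp [Store.reg_setReg, h5, g3], ?_, ?_, fr ?_, by simpa [Store.mem_setReg]⟩
        · simpa [Store.reg_setReg, h26] using if_congr (by simp [suited_succ, hr1]) rfl rfl
        · simp [Store.reg_setReg, testParity_succ, hc1', hm1, h27, g3, val_one_sub]
        · intro x hx
          simp at hx
          simp [Store.reg_setReg, hx]
      · have hm1 : m p = 0 := by
          rcases ZMod.two_cases (m p) with h | h
          · exact h
          · simp [Store.reg_setReg, Store.mem_setReg, g2, g8, g0, h5, hmp, h, ZMod.val_one] at hc3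
        refine Wp.nil <| Wp.nil <| Wp.add <| Wp.nil ?_
        refine ⟨by simp [Store.reg_setReg, h5, g3], ?_, ?_, fr ?_, by simpa [Store.mem_setReg]⟩
        · simpa [Store.reg_setReg, h26] using if_congr (by simp [suited_succ, hr1]) rfl rfl
        · simp [Store.reg_setReg, testParity_succ, hm1, h27]
        · intro x hx
          simp at hx
          simp [Store.reg_setReg, hx]
  · have hc1' : c p = 0 := by
      rcases ZMod.two_cases (c p) with h | h
      · exact h
      · simp [Store.reg_setReg, g2, g15, h5, hcp, h, ZMod.val_one] at hc1
    refine Wp.nil <| Wp.add <| Wp.nil ?_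
    refine ⟨by simp [Store.reg_setReg, h5, g3], ?_, ?_, fr ?_, by simpa [Store.mem_setReg]⟩
    · simpa [Store.reg_setReg, h26] using if_congr (by simp [suited_succ, hc1']) rfl rfl
    · simp [Store.reg_setReg, testParity_succ, hc1', h27]
    · intro x hx
      simp at hx
      simp [Store.reg_setReg, hx]

/-- Count the vote of one sample. -/
def voteStep : Prog := block
  [.load 26 8 4, .add 9 0 4, .load 27 8 9, .const 5 0, .whileLt 5 0 scanStep,
    .ifLt 2 26 (block [.ifLt 2 27 (block [.add 23 23 3]) (block [.add 22 22 3])]) (block []),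
    .add 8 8 3]

/-- Count the votes for and against a candidate row. -/
def countVotes : Prog := block
  [.const 22 0, .const 23 0, .add 8 0 2, .whileLt 8 14 voteStep]

/-- Invariant of the count of votes. -/
structure VoteInv (n k M : ℕ) (r m c : ℕ → ℕ → ZMod 2) (i t : ℕ) (s₀ : Store) (j : ℕ)
    (s : Store) : Prop where
  reg8 : s.reg 8 = n + j
  reg22 : s.reg 22 = votes r m (c t) i n 0 j
  reg23 : s.reg 23 = votes r m (c t) i n 1 j
  frame : Frame [5, 6, 7, 8, 9, 22, 23, 26, 27] s₀ s
  mem : s.mem = s₀.mem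

lemma VoteInv.step {n k M : ℕ} {r m c : ℕ → ℕ → ZMod 2} {i t : ℕ} {s₀ s : Store} {j : ℕ}
    (hR : Ready n k M r m c s₀) (hi : i < n) (ht : t < M) (h4 : s₀.reg 4 = i)
    (h15 : s₀.reg 15 = n + k + t) (hj : j < k) (h : VoteInv n k M r m c i t s₀ j s) :
    Wp voteStep (n * (30 + 1) + 30) s (VoteInv n k M r m c i t s₀ (j + 1)) := by
  classical
  obtain ⟨h8, h22, h23, hF, hM⟩ := h
  have hR' : Ready n k M r m c s := hR.of_frame hF hM (by decide)
  have g4 := (hF 4 (by decide)).trans h4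
  have g15 := (hF 15 (by decide)).trans h15
  obtain ⟨g0, g2, g3, g14, g17, gb, go, gr⟩ := hR'
  refine Wp.load <| Wp.add <| Wp.load <| Wp.const <|
    Wp.cons_le (B := n * (30 + 1) + 1) (B' := 20) (by omega) ?_
  set s1 : Store := (((s.setReg 26 _).setReg 9 _).setReg 27 _).setReg 5 0 with hs1
  have e0 : s1.reg 0 = n := by simp [hs1, Store.reg_setReg, g0]
  have e2 : s1.reg 2 = 0 := by simp [hs1, Store.reg_setReg, g2]
  have e3 : s1.reg 3 = 1 := by simp [hs1, Store.reg_setReg, g3]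
  have e5 : s1.reg 5 = 0 := by simp [hs1, Store.reg_setReg]
  have e8 : s1.reg 8 = n + j := by simp [hs1, Store.reg_setReg, h8]
  have e15 : s1.reg 15 = n + k + t := by simp [hs1, Store.reg_setReg, g15]
  have e22 : s1.reg 22 = _ := (by simp [hs1, Store.reg_setReg] : _ = s.reg 22).trans h22
  have e23 : s1.reg 23 = _ := (by simp [hs1, Store.reg_setReg] : _ = s.reg 23).trans h23
  have e26 : s1.reg 26 = (r j i).val := by simp [hs1, Store.reg_setReg, h8, g4, gb j hj i hi]
  have e27 : s1.reg 27 = (m j i).val := by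
    simp [hs1, Store.reg_setReg, Store.mem_setReg, h8, g4, g0, go j hj i hi]
  have eM : s1.mem = s.mem := rfl
  have eF : Frame [5, 6, 7, 8, 9, 22, 23, 26, 27] s₀ s1 := by
    intro x hx
    rw [← hF x hx]
    simp at hx
    simp [hs1, Store.reg_setReg, hx]
  clear hs1
  clear_value s1
  refine Wp.whileLt (ScanInv n (r j) (m j) (c t) i s1) n ?_ ?_ ?_ ?_
  · refine ⟨e5, ?_, ?_, fun _ _ => rfl, rfl⟩
    · rw [e26]
      -- With no qubit scanned, suitability only says that qubit `i` was measured in the Hadamard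
      -- basis, so the recorded basis bit is the right initial flag.
      rcases ZMod.two_cases (r j i) with h | h <;> simp [Suited, h, ZMod.val_one]
    · simp [testParity, e27]
  · intro p hp s' h
    refine ⟨by rw [h.reg5, h.frame 0 (by decide), e0]; exact hp,
      h.step hp e0 e2 e3 e8 e15 ?_ ?_ ?_⟩ <;> rw [eM]
    exacts [gb j hj, go j hj, gr t ht]
  · intro s' h
    rw [h.reg5, h.frame 0 (by decide), e0]
    exact lt_irrefl _
  · rintro s' ⟨f5, f26, f27, fF, fM⟩
    have f2 := (fF 2 (by decide)).trans e2
    have f3 := (fF 3 (by decide)).trans e3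
    have f8 := (fF 8 (by decide)).trans e8
    have f22 := (fF 22 (by decide)).trans e22
    have f23 := (fF 23 (by decide)).trans e23
    have hFr : ∀ x ∉ [5, 6, 7, 8, 9, 22, 23, 26, 27], s'.reg x = s₀.reg x := by
      intro x hx
      rw [← eF x hx]
      apply fF
      simp at hx ⊢
      omega
    have hMem : s'.mem = s₀.mem := by rw [fM, eM, hM]
    refine Wp.cons_le (B := 10) (B' := 8) (by norm_num) <| Wp.ifLt (fun hc1 => ?_) fun hc1 => ?_
    · have hs : Suited (r j) (c t) i n := by
        by_contra hs
        simp [f2, f26, hs] at hc1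
      refine Wp.cons_le (B := 4) (B' := 2) (by norm_num) <| Wp.ifLt (fun hc2 => ?_) fun hc2 => ?_
      · have hp : testParity (m j) (c t) i n = 1 := by
          rcases ZMod.two_cases (testParity (m j) (c t) i n) with h | h
          · simp [f2, f27, h] at hc2
          · exact h
        refine Wp.add <| Wp.nil <| Wp.nil <| Wp.add <| Wp.nil ?_
        refine ⟨?_, ?_, ?_, ?_, by simpa [Store.mem_setReg] using hMem⟩
        · simp [Store.reg_setReg, f8, f3, add_assoc]
        · simp [Store.reg_setReg, f22, votes_succ, hp]
        · simp [Store.reg_setReg, f23, f3, votes_succ, hs, hp]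
        · intro x hx
          rw [← hFr x hx]
          simp at hx
          simp [Store.reg_setReg, hx]
      · have hp : testParity (m j) (c t) i n = 0 := by
          rcases ZMod.two_cases (testParity (m j) (c t) i n) with h | h
          · exact h
          · simp [f2, f27, h, ZMod.val_one] at hc2
        refine Wp.add <| Wp.nil <| Wp.nil <| Wp.add <| Wp.nil ?_
        refine ⟨?_, ?_, ?_, ?_, by simpa [Store.mem_setReg] using hMem⟩
        · simp [Store.reg_setReg, f8, f3, add_assoc]
        · simp [Store.reg_setReg, f22, f3, votes_succ, hs, hp]
        · simp [Store.reg_setReg, f23, votes_succ, hp]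
        · intro x hx
          rw [← hFr x hx]
          simp at hx
          simp [Store.reg_setReg, hx]
    · have hs : ¬ Suited (r j) (c t) i n := by
        intro hs
        simp [f2, f26, hs] at hc1
      refine Wp.nil <| Wp.add <| Wp.nil ?_
      refine ⟨?_, ?_, ?_, ?_, by simpa [Store.mem_setReg] using hMem⟩
      · simp [Store.reg_setReg, f8, f3, add_assoc]
      · simp [Store.reg_setReg, f22, votes_succ, hs]
      · simp [Store.reg_setReg, f23, votes_succ, hs]
      · intro x hx
        rw [← hFr x hx]
        simp at hx
        simp [Store.reg_setReg, hx]

lemma wp_countVotes {n k M : ℕ} {r m c : ℕ → ℕ → ZMod 2} {i t : ℕ} {s : Store}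
    (hR : Ready n k M r m c s) (hi : i < n) (ht : t < M) (h4 : s.reg 4 = i)
    (h15 : s.reg 15 = n + k + t) :
    Wp countVotes (k * (n * (30 + 1) + 30 + 1) + 20) s fun s' =>
      s'.reg 22 = votes r m (c t) i n 0 k ∧ s'.reg 23 = votes r m (c t) i n 1 k ∧
      Frame [5, 6, 7, 8, 9, 22, 23, 26, 27] s s' ∧ s'.mem = s.mem := by
  refine Wp.const <| Wp.const <| Wp.add <|
    Wp.cons_le (B := k * (n * (30 + 1) + 30 + 1) + 1) (B' := 1) (by omega) ?_
  refine Wp.whileLt (VoteInv n k M r m c i t s) k ?_ ?_ ?_ ?_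
  · refine ⟨?_, ?_, ?_, ?_, by simp [Store.mem_setReg]⟩
    · simp [Store.reg_setReg, hR.reg0, hR.reg2]
    · simp [Store.reg_setReg, votes]
    · simp [Store.reg_setReg, votes]
    · intro x hx
      simp at hx
      simp [Store.reg_setReg, hx]
  · intro j hj s' h
    refine ⟨?_, h.step hR hi ht h4 h15 hj⟩
    rw [h.reg8, h.frame 14 (by decide), hR.reg14]
    omega
  · intro s' h
    rw [h.reg8, h.frame 14 (by decide), hR.reg14]
    exact lt_irrefl _
  · rintro s' ⟨_, f22, f23, fF, fM⟩
    exact Wp.nil ⟨f22, f23, fF, fM⟩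

/-! #### Selection of the best candidates -/

/-- Compare the score of the current candidate with the best score so far. -/
def compareStep : Prog := block
  [countVotes, .sub 24 22 23, .sub 25 23 22,
    .ifLt 19 24 (block [.add 19 24 2, .const 20 0, .add 21 15 2]) (block []),
    .ifLt 19 25 (block [.add 19 25 2, .const 20 1, .add 21 15 2]) (block []),
    .add 15 15 3]

/-- Find the best candidate for row `reg 4` and write it to the output. -/
def evalRow : Prog := block
  [.const 19 0, .const 20 0, .add 21 14 2, .add 15 14 2, .whileLt 15 17 compareStep,
    .store 4 4 20, .add 5 4 3,
    .whileLt 5 0 (block [.load 6 21 5, .store 4 5 6, .add 5 5 3]), .add 4 4 3]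

/-- Write the best candidates for all rows to the output. -/
def evalAll : Prog := block [.const 4 0, .whileLt 4 0 evalRow]

/-- Among the candidates with numbers below `t`, the absolute value of the difference of the numbers
`a` and `b` of votes is at most `best`, and `best` is attained by candidate `u` with sign `g`. -/
structure IsBest (a b : ℕ → ℕ) (best u g t : ℕ) : Prop where
  le_left : ∀ v < t, a v ≤ b v + best
  le_right : ∀ v < t, b v ≤ a v + best
  attained : best = 0 ∨ u < t ∧ (g = 0 ∧ b u + best = a u ∨ g = 1 ∧ a u + best = b u)

lemma IsBest.update {a b : ℕ → ℕ} {best u g t best' u' g' : ℕ} (h : IsBest a b best u g t)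
    (h' : a t - b t ≤ best' ∧ b t - a t ≤ best' ∧ best ≤ best' ∧
      ((best' = best ∧ u' = u ∧ g' = g) ∨
        (u' = t ∧ (g' = 0 ∧ b t + best' = a t ∨ g' = 1 ∧ a t + best' = b t)))) :
    IsBest a b best' u' g' (t + 1) := by
  obtain ⟨h1, h2, h3, h4⟩ := h'
  refine ⟨fun v hv => ?_, fun v hv => ?_, ?_⟩
  · rcases Nat.lt_succ_iff_lt_or_eq.mp hv with h5 | rfl
    · have := h.le_left v h5
      omega
    · omega
  · rcases Nat.lt_succ_iff_lt_or_eq.mp hv with h5 | rfl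
    · have := h.le_right v h5
      omega
    · omega
  · rcases h4 with ⟨rfl, rfl, rfl⟩ | ⟨rfl, h4⟩
    · rcases h.attained with h5 | ⟨h5, h6⟩
      · exact Or.inl h5
      · exact Or.inr ⟨by omega, h6⟩
    · exact Or.inr ⟨by omega, h4⟩

/-- The registers changed by `compareStep`. -/
abbrev compareRegs : List ℕ := [5, 6, 7, 8, 9, 15, 19, 20, 21, 22, 23, 24, 25, 26, 27]

/-- Invariant of the search for the best candidate. -/
structure CompareInv (n k M : ℕ) (r m c : ℕ → ℕ → ZMod 2) (i : ℕ) (s₀ : Store) (t : ℕ)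
    (s : Store) : Prop where
  reg15 : s.reg 15 = n + k + t
  best : ∃ u < M, s.reg 21 = n + k + u ∧
    IsBest (fun t => votes r m (c t) i n 0 k) (fun t => votes r m (c t) i n 1 k)
      (s.reg 19) u (s.reg 20) t
  frame : Frame compareRegs s₀ s
  mem : s.mem = s₀.mem

/-- The two truncated differences of the vote counts are the positive and negative parts of the
score. Comparing each with the record compares the absolute value, and which one wins determines the
sign stored in register 20. -/
lemma CompareInv.step {n k M : ℕ} {r m c : ℕ → ℕ → ZMod 2} {i t : ℕ} {s₀ s : Store}
    (hR : Ready n k M r m c s₀) (hi : i < n) (ht : t < M) (h4 : s₀.reg 4 = i)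
    (h : CompareInv n k M r m c i s₀ t s) :
    Wp compareStep (k * (n * (30 + 1) + 30 + 1) + 60) s (CompareInv n k M r m c i s₀ (t + 1)) := by
  obtain ⟨h15, ⟨u, huM, h21, hb⟩, hF, hM⟩ := h
  have hR' : Ready n k M r m c s := hR.of_frame hF hM (by decide)
  refine Wp.cons_le (B := k * (n * (30 + 1) + 30 + 1) + 20) (B' := 39) (by omega) ?_
  refine (wp_countVotes hR' hi ht ((hF 4 (by decide)).trans h4) h15).mono le_rfl ?_
  rintro s' ⟨g22, g23, gF, gM⟩
  have hR'' : Ready n k M r m c s' := hR'.of_frame gF gM (by decide)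
  have g2 := hR''.reg2
  have g3 := hR''.reg3
  have g15 := (gF 15 (by decide)).trans h15
  have g19 := gF 19 (by decide)
  have g20 := gF 20 (by decide)
  have g21 := (gF 21 (by decide)).trans h21
  have hFr : ∀ x ∉ compareRegs, s'.reg x = s₀.reg x := by
    intro x hx
    rw [← hF x hx]
    apply gF
    simp at hx ⊢
    omega
  have hMem : s'.mem = s₀.mem := by rw [gM, hM]
  rw [← g19, ← g20] at hb
  generalize hA : (fun t => votes r m (c t) i n 0 k) = a at hb
  generalize hB : (fun t => votes r m (c t) i n 1 k) = b at hb
  have g22' : s'.reg 22 = a t := by rw [g22, ← hA]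
  have g23' : s'.reg 23 = b t := by rw [g23, ← hB]
  have fin : ∀ {s'' : Store}, s''.reg 15 = n + k + (t + 1) → s''.mem = s'.mem →
      (∀ x ∉ compareRegs, s''.reg x = s'.reg x) →
      (∃ u < M, s''.reg 21 = n + k + u ∧ IsBest a b (s''.reg 19) u (s''.reg 20) (t + 1)) →
      CompareInv n k M r m c i s₀ (t + 1) s'' := by
    intro s'' f1 f2 f3 f4
    refine ⟨f1, ?_, fun x hx => (f3 x hx).trans (hFr x hx), f2.trans hMem⟩
    rw [hA, hB]
    exact f4
  refine Wp.sub <| Wp.sub <| Wp.cons_le (B := 10) (B' := 24) (by norm_num) <|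
    Wp.ifLt (fun hc1 => ?_) fun hc1 => ?_
  · refine Wp.add <| Wp.const <| Wp.add <| Wp.nil <| Wp.cons_le (B := 10) (B' := 8) (by norm_num) <|
      Wp.ifLt (fun hc2 => ?_) fun hc2 => ?_
    · simp [Store.reg_setReg, g2, g22', g23'] at hc1 hc2
      -- Both updates cannot happen: if the first difference is positive, the other is zero.
      omega
    · simp [Store.reg_setReg, g2, g22', g23'] at hc1 hc2
      refine Wp.nil <| Wp.add <| Wp.nil <| fin ?_ ?_ ?_ ⟨t, ht, ?_, hb.update ?_⟩
      · simp [Store.reg_setReg, g15, g3, add_assoc]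
      · simp [Store.mem_setReg]
      · intro x hx
        simp at hx
        simp [Store.reg_setReg, hx]
      · simp [Store.reg_setReg, g15, g2]
      · simp [Store.reg_setReg, g2, g22', g23']
        omega
  · refine Wp.nil <| Wp.cons_le (B := 10) (B' := 8) (by norm_num) <|
      Wp.ifLt (fun hc2 => ?_) fun hc2 => ?_
    · simp [Store.reg_setReg, g22', g23'] at hc1 hc2
      refine Wp.add <| Wp.const <| Wp.add <| Wp.nil <| Wp.add <| Wp.nil <|
        fin ?_ ?_ ?_ ⟨t, ht, ?_, hb.update ?_⟩
      · simp [Store.reg_setReg, g15, g3, add_assoc]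
      · simp [Store.mem_setReg]
      · intro x hx
        simp at hx
        simp [Store.reg_setReg, hx]
      · simp [Store.reg_setReg, g15, g2]
      · simp [Store.reg_setReg, g2, g22', g23']
        omega
    · simp [Store.reg_setReg, g22', g23'] at hc1 hc2
      refine Wp.nil <| Wp.add <| Wp.nil <| fin ?_ ?_ ?_ ⟨u, huM, ?_, hb.update ?_⟩
      · simp [Store.reg_setReg, g15, g3, add_assoc]
      · simp [Store.mem_setReg]
      · intro x hx
        simp at hx
        simp [Store.reg_setReg, hx]
      · simpa [Store.reg_setReg] using g21
      · simp [Store.reg_setReg]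
        omega

/-- Row `i` of the memory is the upper triangular part of a best candidate for row `i`. -/
def RowCorrect (n k M : ℕ) (r m c : ℕ → ℕ → ZMod 2) (mem : ℕ → ℕ → ℕ) (i : ℕ) : Prop :=
  ∃ best, ∃ u < M, IsBest (fun t => votes r m (c t) i n 0 k) (fun t => votes r m (c t) i n 1 k)
      best u (mem i i) M ∧
    (∀ q < n, i < q → mem i q = (c u q).val) ∧ ∀ q < i, mem i q = 0

/-- The first `i` rows of the output have been written. -/
structure EvalInv (n k M : ℕ) (r m c : ℕ → ℕ → ZMod 2) (i : ℕ) (s : Store) : Prop where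
  ready : Ready n k M r m c s
  reg4 : s.reg 4 = i
  rows : ∀ i' < i, RowCorrect n k M r m c s.mem i'
  zero : ∀ i' < n, i ≤ i' → ∀ q, s.mem i' q = 0

lemma EvalInv.step {n k M : ℕ} {r m c : ℕ → ℕ → ZMod 2} {i : ℕ} {s : Store} (hM : 0 < M)
    (hi : i < n) (h : EvalInv n k M r m c i s) :
    Wp evalRow (M * (k * (n * (30 + 1) + 30 + 1) + 60 + 1) + n * (10 + 1) + 40) s
      (EvalInv n k M r m c (i + 1)) := by
  obtain ⟨hR, h4, hrows, hzero⟩ := h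
  obtain ⟨h0, h2, h3, h14, h17, -, -, -⟩ := id hR
  refine Wp.const <| Wp.const <| Wp.add <| Wp.add <| Wp.cons_le
    (B := M * (k * (n * (30 + 1) + 30 + 1) + 60 + 1) + 1) (B' := n * (10 + 1) + 30) (by omega) ?_
  have hF₀ : Frame compareRegs s
      ((((s.setReg 19 0).setReg 20 0).setReg 21 (s.reg 14 + s.reg 2)).setReg 15
        (s.reg 14 + s.reg 2)) := by
    intro x hx
    simp at hx
    simp [Store.reg_setReg, hx]
  refine Wp.whileLt (CompareInv n k M r m c i s) M ?_ ?_ ?_ ?_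
  · refine ⟨?_, ⟨0, hM, ?_, ?_⟩, ?_, ?_⟩
    · simp [Store.reg_setReg, h14, h2]
    · simp [Store.reg_setReg, h14, h2]
    · exact ⟨by simp, by simp, Or.inl (by simp [Store.reg_setReg])⟩
    · exact hF₀
    · rfl
  · intro t ht s' h
    refine ⟨?_, h.step hR hi ht h4⟩
    rw [h.reg15, h.frame 17 (by decide), h17]
    omega
  · intro s' h
    rw [h.reg15, h.frame 17 (by decide), h17]
    exact lt_irrefl _
  rintro s1 ⟨-, ⟨u, huM, f21, hb⟩, fF, fM⟩
  have hR1 : Ready n k M r m c s1 := hR.of_frame fF fM (by decide)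
  have f4 := (fF 4 (by decide)).trans h4
  have hqu := hR1.rows u huM
  refine Wp.store <| Wp.add ?_
  set s2 : Store := (s1.setMem _ _ _).setReg 5 _ with hs2
  have e0 : s2.reg 0 = n := by simpa [hs2, Store.reg_setReg, Store.reg_setMem] using hR1.reg0
  have e2 : s2.reg 2 = 0 := by simpa [hs2, Store.reg_setReg, Store.reg_setMem] using hR1.reg2
  have e3 : s2.reg 3 = 1 := by simpa [hs2, Store.reg_setReg, Store.reg_setMem] using hR1.reg3
  have e14 : s2.reg 14 = s1.reg 14 := by simp [hs2, Store.reg_setReg, Store.reg_setMem]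
  have e17 : s2.reg 17 = s1.reg 17 := by simp [hs2, Store.reg_setReg, Store.reg_setMem]
  have e4 : s2.reg 4 = i := by simpa [hs2, Store.reg_setReg, Store.reg_setMem] using f4
  have e5 : s2.reg 5 = i + 1 := by
    simp [hs2, Store.reg_setReg, Store.reg_setMem, f4, hR1.reg3]
  have e21 : s2.reg 21 = n + k + u := by
    simpa [hs2, Store.reg_setReg, Store.reg_setMem] using f21
  have em : ∀ a b, s2.mem a b = if a = i ∧ b = i then s1.reg 20 else s.mem a b := by
    intro a b
    simp [hs2, Store.mem_setReg, Store.mem_setMem, f4, fM]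
  clear hs2
  clear_value s2
  refine Wp.cons_le (B := (n - (i + 1)) * (10 + 1) + 1) (B' := 10)
    (by have : (n - (i + 1)) * (10 + 1) ≤ n * (10 + 1) := by gcongr; omega
        -- The copy loop starts to the right of the diagonal, so it makes only `n - (i + 1)` rounds;
        -- the uniform bound with `n` rounds is enough.
        omega) ?_
  refine Wp.whileLt (fun p s' => s'.reg 5 = i + 1 + p ∧ Frame [5, 6] s2 s' ∧
    ∀ a b, s'.mem a b = if a = i ∧ i + 1 ≤ b ∧ b < i + 1 + p then (c u b).val else s2.mem a b)
    (n - (i + 1)) ?_ ?_ ?_ ?_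
  · refine ⟨e5, fun _ _ => rfl, fun a b => ?_⟩
    rw [if_neg (by omega)]
  · rintro p hp s' ⟨g5, gF, gm⟩
    have g0 := (gF 0 (by decide)).trans e0
    have g3 := (gF 3 (by decide)).trans e3
    have g4 := (gF 4 (by decide)).trans e4
    have g21 := (gF 21 (by decide)).trans e21
    refine ⟨by rw [g5, g0]; omega, Wp.load <| Wp.store <| Wp.add <| Wp.nil ⟨?_, ?_, ?_⟩⟩
    · simp [Store.reg_setReg, Store.reg_setMem, g5, g3, add_assoc]
    · intro x hx
      rw [← gF x hx]
      simp at hx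
      simp [Store.reg_setReg, Store.reg_setMem, hx]
    · intro a b
      have hsrc : s'.mem (n + k + u) (i + 1 + p) = (c u (i + 1 + p)).val := by
        rw [gm, if_neg (by omega), em, if_neg (by omega), ← hqu _ (by omega), fM]
      simp only [Store.mem_setReg, Store.mem_setMem, Store.reg_setReg, g4, g5, g21, Nat.reduceEqDiff,
        reduceIte]
      by_cases hab : a = i ∧ b = i + 1 + p
      · obtain ⟨rfl, rfl⟩ := hab
        simp [hsrc]
      · simp only [gm]
        by_cases h1 : a = i ∧ i + 1 ≤ b ∧ b < i + 1 + p
        · rw [if_neg hab, if_pos h1, if_pos (by omega)]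
        · rw [if_neg hab, if_neg h1, if_neg (by omega)]
  · rintro s' ⟨g5, gF, -⟩
    rw [g5, gF 0 (by decide), e0]
    omega
  rintro s' ⟨-, gF, gm⟩
  have hmem : ∀ a b, s'.mem a b = if a = i ∧ i < b ∧ b < n then (c u b).val else
      if a = i ∧ b = i then s1.reg 20 else s.mem a b := by
    intro a b
    rw [gm, em]
    refine if_congr ?_ rfl rfl
    omega
  refine Wp.add <| Wp.nil ⟨?_, ?_, ?_, ?_⟩
  · refine hR1.of_eq ?_ ?_ ?_ ?_ ?_ ?_
    · simp [Store.reg_setReg, gF 0 (by decide), e0, hR1.reg0]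
    · simp [Store.reg_setReg, gF 2 (by decide), e2, hR1.reg2]
    · simp [Store.reg_setReg, gF 3 (by decide), e3, hR1.reg3]
    · simp [Store.reg_setReg, gF 14 (by decide), e14]
    · simp [Store.reg_setReg, gF 17 (by decide), e17]
    · intro a ha
      ext b
      -- Output goes to memory rows below `n`, while samples and candidates lie in rows from `n` on,
      -- so the data survive.
      rw [Store.mem_setReg, hmem, if_neg (by omega), if_neg (by omega), fM]
  · simp [Store.reg_setReg, gF 4 (by decide), gF 3 (by decide), e4, e3]
  · intro i' hi'
    rw [Store.mem_setReg]
    by_cases hii : i' = i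
    · subst hii
      refine ⟨s1.reg 19, u, huM, ?_, ?_, ?_⟩
      · rw [hmem, if_neg (by omega), if_pos ⟨rfl, rfl⟩]
        exact hb
      · intro q hq hiq
        rw [hmem, if_pos ⟨rfl, hiq, hq⟩]
      · intro q hq
        rw [hmem, if_neg (by omega), if_neg (by omega)]
        exact hzero _ hi le_rfl _
    · obtain ⟨best, v, hv, hbest, hq1, hq2⟩ := hrows i' (by omega)
      have hrow : ∀ b, s'.mem i' b = s.mem i' b := by
        intro b
        rw [hmem, if_neg (by omega), if_neg (by omega)]
      refine ⟨best, v, hv, ?_, ?_, ?_⟩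
      · rw [hrow]; exact hbest
      · intro q hq hiq
        rw [hrow, hq1 q hq hiq]
      · intro q hq
        rw [hrow, hq2 q hq]
  · intro i' hi' hii q
    rw [Store.mem_setReg, hmem, if_neg (by omega), if_neg (by omega)]
    exact hzero i' hi' (by omega) q

lemma wp_evalAll {n k M : ℕ} {r m c : ℕ → ℕ → ZMod 2} {s : Store} (hM : 0 < M)
    (hR : Ready n k M r m c s) (hz : ∀ i < n, ∀ q, s.mem i q = 0) :
    Wp evalAll
      (n * (M * (k * (n * (30 + 1) + 30 + 1) + 60 + 1) + n * (10 + 1) + 40 + 1) + 10) s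
      fun s' => ∀ i < n, RowCorrect n k M r m c s'.mem i := by
  refine Wp.const <| Wp.cons_le (B := n * (M * (k * (n * (30 + 1) + 30 + 1) + 60 + 1) +
    n * (10 + 1) + 40 + 1) + 1) (B' := 1) (by omega) ?_
  refine Wp.whileLt (EvalInv n k M r m c) n ?_ ?_ ?_ ?_
  · refine ⟨?_, by simp [Store.reg_setReg], by simp, fun i hi _ q => hz i hi q⟩
    exact hR.of_frame (l := [4]) (fun x hx => by simp at hx; simp [Store.reg_setReg, hx]) rfl
      (by decide)
  · intro i hi s' h
    exact ⟨by rw [h.reg4, h.ready.reg0]; exact hi, h.step hM hi⟩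
  · intro s' h
    rw [h.reg4, h.ready.reg0]
    exact lt_irrefl _
  · intro s' h
    exact Wp.nil h.rows

/-! #### The whole program -/

/-- The classical post-processing. -/
def postprocess : List Prog := [powSqrt, buildTable, evalAll]

/-- A bound for the running time of the classical post-processing. -/
def postTime (n k : ℕ) : ℕ :=
  (Nat.sqrt (n - 1) + 1) * 11 + 20 + (tableSize n * (n * (10 + 1) + 30 + 1) + 13) +
    (n * (tableSize n * (k * (n * (30 + 1) + 30 + 1) + 60 + 1) + n * (10 + 1) + 40 + 1) + 10) + 4

lemma wp_postprocess {n k : ℕ} (hn : 0 < n) {r m : ℕ → ℕ → ZMod 2} (s : Store) (h0 : s.reg 0 = n)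
    (h1 : s.reg 1 = k) (h2 : s.reg 2 = 0) (h3 : s.reg 3 = 1)
    (hb : ∀ j < k, ∀ q < n, s.mem (n + j) q = (r j q).val)
    (ho : ∀ j < k, ∀ q < n, s.mem (n + j) (n + q) = (m j q).val)
    (hf : ∀ a b, a < n ∨ n + k ≤ a → s.mem a b = 0) :
    Wp (block postprocess) (postTime n k) s
      fun s' => ∀ i < n, RowCorrect n k (tableSize n) r m (rowVec n) s'.mem i := by
  have hM : 0 < tableSize n := Nat.two_pow_pos _
  refine Wp.cons_le (B' := (tableSize n * (n * (10 + 1) + 30 + 1) + 13) +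
    (n * (tableSize n * (k * (n * (30 + 1) + 30 + 1) + 60 + 1) + n * (10 + 1) + 40 + 1) + 10) + 3)
    ?_ ((wp_powSqrt hn s h0).mono le_rfl ?_)
  · rw [postTime]; omega
  rintro s1 ⟨g10, gF, gM⟩
  refine Wp.cons_le (B' :=
    (n * (tableSize n * (k * (n * (30 + 1) + 30 + 1) + 60 + 1) + n * (10 + 1) + 40 + 1) + 10) + 2)
    (by omega) ((wp_buildTable hn s1 ((gF 0 (by decide)).trans h0) ((gF 1 (by decide)).trans h1)
      ((gF 2 (by decide)).trans h2) ((gF 3 (by decide)).trans h3) g10 ?_).mono le_rfl ?_)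
  · intro q _
    rw [gM]
    exact hf _ _ (Or.inr le_rfl)
  intro s2 h
  refine Wp.cons_le (B' := 1) (by omega) ((wp_evalAll (n := n) (k := k) (r := r) (m := m) (c := rowVec n)
    hM ?_ ?_).mono le_rfl ?_)
  · refine ⟨h.reg0, h.reg2, h.reg3, h.reg14, h.reg17, ?_, ?_, fun t ht => h.rows t ht.le⟩
    · intro j hj q hq
      rw [h.frame _ (by omega), gM, hb j hj q hq]
    · intro j hj q hq
      rw [h.frame _ (by omega), gM, ho j hj q hq]
  · intro i hi q
    rw [h.frame _ (by omega), gM]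
    exact hf _ _ (Or.inl hi)
  · intro s' h'
    exact Wp.nil h'

/-- The learning algorithm. -/
def learner : Prog := block (.const 3 1 :: measureAll :: postprocess)

/-! ### The distribution of the outcomes -/

/-- The sign `(-1)^a`. -/
def sgn (a : ZMod 2) : ℝ := (-1) ^ a.val

lemma sgn_zero : sgn 0 = 1 := by simp [sgn]

lemma sgn_one : sgn 1 = -1 := by simp [sgn, ZMod.val_one]

lemma sgn_add (a b : ZMod 2) : sgn (a + b) = sgn a * sgn b := by
  rcases ZMod.two_cases a with rfl | rfl <;> rcases ZMod.two_cases b with rfl | rfl <;>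
    simp [sgn_zero, sgn_one, show (1 + 1 : ZMod 2) = 0 from rfl]

lemma sgn_sum {ι : Type*} (s : Finset ι) (f : ι → ZMod 2) :
    sgn (∑ i ∈ s, f i) = ∏ i ∈ s, sgn (f i) := by
  classical
  induction s using Finset.induction_on with
  | empty => simp [sgn_zero]
  | insert a s ha ih => rw [Finset.sum_insert ha, Finset.prod_insert ha, sgn_add, ih]

lemma sgn_mul_self (a : ZMod 2) : sgn a * sgn a = 1 := by
  rcases ZMod.two_cases a with rfl | rfl <;> simp [sgn_zero, sgn_one]

lemma sum_zmod_two {M : Type*} [AddCommMonoid M] (f : ZMod 2 → M) : ∑ a, f a = f 0 + f 1 :=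
  Fin.sum_univ_two f

/-- The vector that is projected on by outcome `x.2` in basis `x.1`. -/
noncomputable def basisVec (x : ZMod 2 × ZMod 2) (a : ZMod 2) : ℝ :=
  if x.1 = 1 then 1 / Real.sqrt 2 * sgn (x.2 * a) else if a = x.2 then 1 else 0

lemma basisVec_mul (x : ZMod 2 × ZMod 2) (a b : ZMod 2) :
    basisVec x a * basisVec x b =
      if x.1 = 1 then 1 / 2 * sgn (x.2 * (a + b)) else if a = x.2 ∧ b = x.2 then 1 else 0 := by
  have h2 : 1 / Real.sqrt 2 * (1 / Real.sqrt 2) = 1 / 2 := by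
    rw [div_mul_div_comm, Real.mul_self_sqrt (by norm_num)]; norm_num
  simp only [basisVec]
  split_ifs with h h' h'' <;> try simp_all
  rw [mul_mul_mul_comm, ← mul_inv, Real.mul_self_sqrt (by norm_num), ← sgn_add, mul_add]

lemma gram_basisKraus (x : ZMod 2 × ZMod 2) (a b : ZMod 2) :
    gram (basisKraus x) a b = ((basisVec x a * basisVec x b : ℝ) : ℂ) := by
  have h : ∀ c a, basisKraus x c a = if c = x.2 then ((basisVec x a : ℝ) : ℂ) else 0 := by
    intro c a
    obtain ⟨r, m⟩ := x
    simp only [basisKraus, basisVec]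
    rcases ZMod.two_cases r with rfl | rfl
    · simp only [zero_ne_one, if_false, mul_one, Matrix.single_apply]
      by_cases hc : c = m
      · subst hc
        by_cases ha : c = a
        · simp [ha]
        · simp [ha, Ne.symm ha]
      · simp [hc, Ne.symm hc]
    · simp only [if_true]
      by_cases hc : c = m
      · subst hc
        rcases ZMod.two_cases c with rfl | rfl <;> rcases ZMod.two_cases a with rfl | rfl <;>
          simp [gateH, sgn, ZMod.val_one]
      · simp [hc]
  simp only [gram, h]
  rw [Finset.sum_eq_single x.2 (by intro c _ hc; simp [hc]) (by simp)]
  simp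

/-- The matrix element of the measurement of a depolarized qubit with basis and outcome `x`. -/
noncomputable def noisyElement (ε : ℝ) (x : ZMod 2 × ZMod 2) (a b : ZMod 2) : ℝ :=
  (1 - ε) * (basisVec x a * basisVec x b) + if a = b then ε / 2 else 0

lemma sum_basisVec_sq (x : ZMod 2 × ZMod 2) :
    basisVec x 0 * basisVec x 0 + basisVec x 1 * basisVec x 1 = 1 := by
  obtain ⟨r, m⟩ := x
  simp only [basisVec_mul]
  rcases ZMod.two_cases r with rfl | rfl <;> rcases ZMod.two_cases m with rfl | rfl <;>
    simp [sgn_zero, show (1 + 1 : ZMod 2) = 0 from rfl] <;> norm_num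

/-- In the Heisenberg picture the channel acts on the effect, `E ↦ (1 - ε) E + ε Tr(E) I/2`, and
here `Tr E = 1` because the measured vector is a unit vector. -/
lemma sum_depol_gram (ε : ℝ) (x : ZMod 2 × ZMod 2) (u v : ZMod 2) :
    ∑ a, ∑ b, depol ε (Matrix.single u v 1) a b * gram (basisKraus x) a b =
      (noisyElement ε x u v : ℂ) := by
  have h := congrArg (fun r : ℝ => (r : ℂ)) (sum_basisVec_sq x)
  push_cast at h
  simp only [gram_basisKraus, sum_zmod_two, depol, noisyElement]
  rcases ZMod.two_cases u with rfl | rfl <;> rcases ZMod.two_cases v with rfl | rfl <;>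
    simp [Matrix.trace] <;> linear_combination (ε / 2 : ℂ) * h

/-- The amplitudes of the phase state, as real numbers. -/
noncomputable def amp {n : ℕ} (A : Matrix (Fin n) (Fin n) (ZMod 2)) (x : Bits (Fin n)) : ℝ :=
  1 / Real.sqrt ((2 : ℝ) ^ n) * sgn (quadForm A x)

lemma phaseVec_eq_amp {n : ℕ} (A : Matrix (Fin n) (Fin n) (ZMod 2)) (x : Bits (Fin n)) :
    phaseVec A x = (amp A x : ℂ) := by
  simp [phaseVec, amp, sgn]

lemma amp_mul_amp {n : ℕ} (A : Matrix (Fin n) (Fin n) (ZMod 2)) (x y : Bits (Fin n)) :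
    amp A x * amp A y = (1 / 2) ^ n * sgn (quadForm A x + quadForm A y) := by
  rw [amp, amp, mul_mul_mul_comm, ← sgn_add, div_mul_div_comm, Real.mul_self_sqrt (by positivity)]
  simp

/-- The probability of the bases and outcomes `x` for one copy of the noisy phase state. -/
noncomputable def sampleWeight {n : ℕ} (ε : ℝ) (A : Matrix (Fin n) (Fin n) (ZMod 2))
    (x : Fin n → ZMod 2 × ZMod 2) : ℝ :=
  ∑ u, ∑ v, amp A u * amp A v * ∏ q, (1 / 2 * noisyElement ε (x q) (u q) (v q))

/-- The factor `2 ^ n` appears because `sampleWeight` includes the probabilities of the basis coins,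
whereas here the bases are given. -/
lemma trace_sample {n : ℕ} (ε : ℝ) (A : Matrix (Fin n) (Fin n) (ZMod 2))
    (x : Fin n → ZMod 2 × ZMod 2) :
    ∑ y, ∑ z, localDepol ε (phaseState A) y z * ∏ q, gram (basisKraus (x q)) (y q) (z q) =
      ((2 ^ n * sampleWeight ε A x : ℝ) : ℂ) := by
  rw [trace_localDepol ε (phaseState A) fun q => gram (basisKraus (x q))]
  simp only [sum_depol_gram, phaseState, Matrix.vecMulVec_apply, Pi.star_apply, phaseVec_eq_amp,
    sampleWeight, RCLike.star_def, Complex.conj_ofReal, Finset.prod_mul_distrib,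
    Finset.prod_const, Finset.card_univ, Fintype.card_fin, Finset.mul_sum]
  push_cast
  refine Finset.sum_congr rfl fun u _ => Finset.sum_congr rfl fun v _ => ?_
  have : (2 : ℂ) ^ n * (1 / 2) ^ n = 1 := by rw [← mul_pow]; norm_num
  linear_combination (-(amp A u * amp A v * ∏ q, (noisyElement ε (x q) (u q) (v q) : ℂ))) * this

/-- Each noisy effect is a nonnegative mixture of rank-one real forms: the measured vector with
weight `(1 - ε)/2` and each of the two standard basis vectors with weight `ε/4`. Expanding the
product over the qubits gives a weighted sum of squares. -/
lemma sampleWeight_nonneg {n : ℕ} {ε : ℝ} (h0 : 0 ≤ ε) (h1 : ε ≤ 1)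
    (A : Matrix (Fin n) (Fin n) (ZMod 2)) (x : Fin n → ZMod 2 × ZMod 2) :
    0 ≤ sampleWeight ε A x := by
  let p : Option (ZMod 2) → ℝ := fun c => c.elim (1 / 2 * (1 - ε)) fun _ => 1 / 2 * (ε / 2)
  let e : ZMod 2 × ZMod 2 → Option (ZMod 2) → ZMod 2 → ℝ :=
    fun x c a => c.elim (basisVec x a) fun d => if a = d then 1 else 0
  have hp : ∀ c, 0 ≤ p c := by
    rintro (_ | c) <;> simp only [p, Option.elim] <;> linarith
  have h : ∀ x a b, 1 / 2 * noisyElement ε x a b = ∑ c, p c * e x c a * e x c b := by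
    intro x a b
    simp only [Fintype.sum_option, sum_zmod_two, p, e, Option.elim, noisyElement]
    rcases ZMod.two_cases a with rfl | rfl <;> rcases ZMod.two_cases b with rfl | rfl <;>
      simp <;> ring
  have key : sampleWeight ε A x = ∑ c : Fin n → Option (ZMod 2),
      (∏ q, p (c q)) * (∑ u, amp A u * ∏ q, e (x q) (c q) (u q)) ^ 2 := by
    simp only [sampleWeight, h, Finset.prod_univ_sum, Fintype.piFinset_univ, Finset.mul_sum,
      Finset.prod_mul_distrib, sq, Finset.sum_mul]
    rw [Finset.sum_comm' (t' := Finset.univ) (s' := fun _ => Finset.univ) (by simp)]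
    rw [Finset.sum_congr rfl fun v _ => Finset.sum_comm, Finset.sum_comm]
    refine Finset.sum_congr rfl fun c _ => Finset.sum_congr rfl fun v _ =>
      Finset.sum_congr rfl fun u _ => ?_
    ring
  rw [key]
  exact Finset.sum_nonneg fun c _ =>
    mul_nonneg (Finset.prod_nonneg fun q _ => hp _) (sq_nonneg _)

/-- For a statistic that is a product over the qubits, averaging over bases and outcomes replaces
each qubit by one `2 × 2` matrix. -/
lemma sum_sampleWeight_mul_prod {n : ℕ} (ε : ℝ) (A : Matrix (Fin n) (Fin n) (ZMod 2))
    (φ : Fin n → ZMod 2 × ZMod 2 → ℝ) :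
    ∑ x, sampleWeight ε A x * ∏ q, φ q (x q) =
      ∑ u, ∑ v, amp A u * amp A v *
        ∏ q, ∑ x, φ q x * (1 / 2 * noisyElement ε x (u q) (v q)) := by
  simp only [sampleWeight, Finset.prod_univ_sum, Fintype.piFinset_univ, Finset.mul_sum,
    Finset.sum_mul]
  rw [Finset.sum_comm]
  refine Finset.sum_congr rfl fun u _ => ?_
  rw [Finset.sum_comm]
  refine Finset.sum_congr rfl fun v _ => Finset.sum_congr rfl fun x _ => ?_
  rw [Finset.prod_mul_distrib (f := fun q => φ q (x q))]
  ring

/-- Completeness of the measurement: the effects, weighted by the coin, add up to the identity. -/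
lemma sum_noisyElement (ε : ℝ) (a b : ZMod 2) :
    ∑ x, (1 / 2 * noisyElement ε x a b) = if a = b then 1 else 0 := by
  simp only [Fintype.sum_prod_type, sum_zmod_two, noisyElement, basisVec_mul]
  rcases ZMod.two_cases a with rfl | rfl <;> rcases ZMod.two_cases b with rfl | rfl <;>
    simp [sgn_zero, sgn_one, show (1 + 1 : ZMod 2) = 0 from rfl] <;> ring

lemma prod_indicator {ι α : Type*} [Fintype ι] [DecidableEq α] [DecidableEq ι] [Fintype α]
    (u v : ι → α) : (∏ q, if u q = v q then (1 : ℝ) else 0) = if u = v then 1 else 0 := by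
  rw [Finset.prod_ite_zero]
  simp [funext_iff]

lemma sum_sampleWeight {n : ℕ} (ε : ℝ) (A : Matrix (Fin n) (Fin n) (ZMod 2)) :
    ∑ x, sampleWeight ε A x = 1 := by
  have h := sum_sampleWeight_mul_prod ε A fun _ _ => 1
  simp only [Finset.prod_const_one, mul_one, one_mul, sum_noisyElement, prod_indicator] at h
  rw [h]
  simp only [mul_ite, mul_one, mul_zero, Finset.sum_ite_eq, Finset.mem_univ, if_true, amp_mul_amp,
    sgn_add, sgn_mul_self, Finset.sum_const, Finset.card_univ]
  simp

/-! ### The test statistic -/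

/-- One factor of the test statistic. -/
noncomputable def testFactor {n : ℕ} (i : Fin n) (s : Bits (Fin n)) (q : Fin n)
    (x : ZMod 2 × ZMod 2) : ℝ :=
  (if q = i then if x.1 = 1 then sgn x.2 else 0 else 1) *
    if s q = 1 then if x.1 = 0 then sgn x.2 else 0 else 1

/-- The test statistic for candidate `s` for row `i`: zero if the bases of the sample are not suited
for this test, and otherwise the sign of the parity. -/
noncomputable def testStat {n : ℕ} (i : Fin n) (s : Bits (Fin n)) (x : Fin n → ZMod 2 × ZMod 2) :
    ℝ := ∏ q, testFactor i s q (x q)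

/-- The expectation of the test statistic. -/
noncomputable def testMean {n : ℕ} (ε : ℝ) (A : Matrix (Fin n) (Fin n) (ZMod 2)) (i : Fin n)
    (s : Bits (Fin n)) : ℝ :=
  if s = (A + A.transpose) i then
    ((1 - ε) / 2) ^ (Finset.univ.filter fun q => q = i ∨ s q = 1).card * sgn (A i i) else 0

/-- Averaging turns the factor at `i` into `(1 - ε)/2` times Pauli `X`, a factor on the support of
`s` into `(1 - ε)/2` times Pauli `Z`, and all others into the identity. If `s i = 1`, qubit `i`
would have to be measured in both bases, and the result is zero. -/
lemma sum_testFactor {n : ℕ} (ε : ℝ) (i : Fin n) (s : Bits (Fin n)) (q : Fin n) (a b : ZMod 2) :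
    ∑ x, testFactor i s q x * (1 / 2 * noisyElement ε x a b) =
      if q = i then if s q = 1 then 0 else if a = b then 0 else (1 - ε) / 2
      else if a = b then if s q = 1 then (1 - ε) / 2 * sgn a else 1 else 0 := by
  by_cases hq : q = i <;> by_cases hs : s q = 1
  · simp only [Fintype.sum_prod_type, sum_zmod_two, testFactor, hq]
    subst hq
    simp [hs]
  · simp only [Fintype.sum_prod_type, sum_zmod_two, noisyElement, basisVec_mul, testFactor]
    rcases ZMod.two_cases a with rfl | rfl <;> rcases ZMod.two_cases b with rfl | rfl <;>
      simp [hq, hq ▸ hs, sgn_zero, sgn_one, show (1 + 1 : ZMod 2) = 0 from rfl] <;> ring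
  · simp only [Fintype.sum_prod_type, sum_zmod_two, noisyElement, basisVec_mul, testFactor]
    rcases ZMod.two_cases a with rfl | rfl <;> rcases ZMod.two_cases b with rfl | rfl <;>
      simp [hq, hs, sgn_zero, sgn_one, show (1 + 1 : ZMod 2) = 0 from rfl] <;> ring
  · simp only [testFactor, hq, hs, if_false, mul_one, one_mul, sum_noisyElement]

/-- The derivative of a quadratic form in direction `e_i` is affine, with linear part given by the
polarization `A + Aᵀ`. -/
lemma quadForm_update {n : ℕ} (A : Matrix (Fin n) (Fin n) (ZMod 2)) (u : Bits (Fin n)) (i : Fin n) :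
    quadForm A u + quadForm A (Function.update u i (u i + 1)) =
      A i i + ∑ q, (A + A.transpose) i q * u q := by
  have h : Function.update u i (u i + 1) = u + Pi.single i 1 := by
    ext q
    by_cases hq : q = i
    · subst hq; simp
    · simp [hq]
  have h1 : ∑ q, (A + A.transpose) i q * u q = (A.mulVec u) i + ∑ q, u q * A q i := by
    simp only [Matrix.mulVec, dotProduct, ← Finset.sum_add_distrib, Matrix.add_apply,
      Matrix.transpose_apply]
    exact Finset.sum_congr rfl fun q _ => by ring
  rw [h, h1, quadForm, quadForm, Matrix.mulVec_add, dotProduct_add, add_dotProduct, add_dotProduct]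
  simp only [Matrix.mulVec_single_one, single_dotProduct, one_mul]
  simp only [dotProduct, Matrix.col_apply]
  have := CharTwo.add_self_eq_zero (∑ q, u q * A.mulVec u q)
  linear_combination this

/-- Orthogonality of the characters of `F_2^n`. -/
lemma sum_prod_sgn {n : ℕ} (c : Fin n → ZMod 2) :
    ∑ u : Bits (Fin n), ∏ q, (1 / 2 * sgn (c q * u q)) = if c = 0 then 1 else 0 := by
  have h := Finset.prod_univ_sum (fun _ : Fin n => (Finset.univ : Finset (ZMod 2)))
    fun q a => 1 / 2 * sgn (c q * a)
  rw [Fintype.piFinset_univ] at h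
  rw [← h]
  have h' : ∀ q, ∑ a, 1 / 2 * sgn (c q * a) = if c q = 0 then 1 else 0 := by
    intro q
    rw [sum_zmod_two]
    rcases ZMod.two_cases (c q) with h | h <;> simp [h, sgn_zero, sgn_one]
    norm_num
  simp only [h']
  rw [Finset.prod_ite_zero]
  simp [funext_iff]

lemma sum_sampleWeight_mul_testStat {n : ℕ} (ε : ℝ) (A : Matrix (Fin n) (Fin n) (ZMod 2))
    (i : Fin n) (s : Bits (Fin n)) :
    ∑ x, sampleWeight ε A x * testStat i s x = testMean ε A i s := by
  simp only [testStat]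
  rw [sum_sampleWeight_mul_prod]
  simp only [sum_testFactor]
  by_cases hs : s i = 1
  · rw [testMean, if_neg]
    · refine Finset.sum_eq_zero fun u _ => Finset.sum_eq_zero fun v _ => ?_
      rw [Finset.prod_eq_zero (Finset.mem_univ i) (by simp [hs]), mul_zero]
    -- The true row has a zero in position `i`, as the diagonal of `A + Aᵀ` vanishes in
    -- characteristic two.
    · rintro rfl
      rw [Matrix.add_apply, Matrix.transpose_apply, CharTwo.add_self_eq_zero] at hs
      exact zero_ne_one hs
  have hs0 : s i = 0 := (ZMod.two_cases (s i)).resolve_right hs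
  have key : ∀ u : Bits (Fin n), (∑ v : Bits (Fin n), amp A u * amp A v * ∏ q,
      if q = i then if s q = 1 then 0 else if u q = v q then 0 else (1 - ε) / 2
      else if u q = v q then if s q = 1 then (1 - ε) / 2 * sgn (u q) else 1 else 0) =
      ((1 - ε) / 2) ^ (Finset.univ.filter fun q => q = i ∨ s q = 1).card * sgn (A i i) *
        ∏ q, (1 / 2 * sgn (((A + A.transpose) i + s) q * u q)) := by
    intro u
    -- The only `X` acts on qubit `i`, so `u` is paired only with its flip at `i`. The two phases
    -- then combine to the derivative of `f`, and together with the `Z` signs give a character with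
    -- frequency `(A + Aᵀ) i + s`.
    rw [Finset.sum_eq_single (Function.update u i (u i + 1))]
    · rw [amp_mul_amp, quadForm_update, sgn_add, sgn_sum, Finset.prod_mul_distrib,
        Finset.prod_const, Finset.card_univ, Fintype.card_fin, ← Finset.prod_const,
        Finset.prod_filter]
      have e : ∀ q, (if q = i then if s q = 1 then 0 else
          if u q = Function.update u i (u i + 1) q then 0 else (1 - ε) / 2
          else if u q = Function.update u i (u i + 1) q then
            if s q = 1 then (1 - ε) / 2 * sgn (u q) else 1 else 0) =
          (if q = i ∨ s q = 1 then (1 - ε) / 2 else 1) * sgn (s q * u q) := by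
        intro q
        by_cases hq : q = i
        · subst hq; simp [hs0, sgn_zero]
        · rcases ZMod.two_cases (s q) with h | h <;> simp [hq, h, sgn_zero]
      simp only [e, Pi.add_apply, add_mul, sgn_add, Finset.prod_mul_distrib]
      ring
    · intro v _ hv
      by_cases hv' : ∃ q, q ≠ i ∧ u q ≠ v q
      · obtain ⟨q, hq, huv⟩ := hv'
        rw [Finset.prod_eq_zero (Finset.mem_univ q) (by simp [hq, huv]), mul_zero]
      · push Not at hv'
        have huv : u i = v i := by
          by_contra huv
          refine hv (funext fun q => ?_)
          by_cases hq : q = i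
          · subst hq
            rw [Function.update_self]
            revert huv
            generalize u q = a
            generalize v q = b
            revert a b
            decide
          · rw [Function.update_of_ne hq, hv' q hq]
        rw [Finset.prod_eq_zero (Finset.mem_univ i) (by simp [huv]), mul_zero]
    · simp
  rw [Finset.sum_congr rfl fun u _ => key u, ← Finset.mul_sum, sum_prod_sgn, testMean]
  have hiff : (A + A.transpose) i + s = 0 ↔ s = (A + A.transpose) i := by
    simp only [funext_iff, Pi.add_apply, Pi.zero_apply, CharTwo.add_eq_zero]
    exact forall_congr' fun q => eq_comm
  by_cases h : s = (A + A.transpose) i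
  · rw [if_pos (hiff.mpr h), if_pos h, mul_one]
  · rw [if_neg (mt hiff.mp h), if_neg h, mul_zero]

lemma abs_testStat_le {n : ℕ} (i : Fin n) (s : Bits (Fin n)) (x : Fin n → ZMod 2 × ZMod 2) :
    |testStat i s x| ≤ 1 := by
  rw [testStat, Finset.abs_prod]
  refine Finset.prod_le_one (fun _ _ => abs_nonneg _) fun q _ => ?_
  have h : ∀ a, |sgn a| = 1 := by
    intro a
    rcases ZMod.two_cases a with rfl | rfl <;> simp [sgn_zero, sgn_one]
  rw [testFactor, abs_mul]
  refine mul_le_one₀ ?_ (abs_nonneg _) ?_ <;> split_ifs <;> simp [h]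

/-! ### Concentration -/

section Concentration

variable {X : Type} [Fintype X] (W : X → ℝ)

lemma sum_prod_weight (k : ℕ) (f : X → ℝ) :
    ∑ ω : Fin k → X, ∏ j, (W (ω j) * f (ω j)) = (∑ x, W x * f x) ^ k := by
  have h := Finset.prod_univ_sum (fun _ : Fin k => (Finset.univ : Finset X))
    fun _ x => W x * f x
  rw [Fintype.piFinset_univ] at h
  rw [← h]
  simp

open Classical in
/-- Chernoff's inequality for a sum of independent bounded variables. -/
lemma chernoff (hW : ∀ x, 0 ≤ W x) (hW1 : ∑ x, W x = 1) (k : ℕ) (f : X → ℝ) (hf : ∀ x, |f x| ≤ 1)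
    (τ : ℝ) (h0 : 0 ≤ τ) (h2 : τ ≤ 2) :
    ∑ ω : Fin k → X, (if k * (∑ x, W x * f x) + k * τ ≤ ∑ j, f (ω j) then ∏ j, W (ω j) else 0) ≤
      Real.exp (-(k * τ ^ 2 / 4)) := by
  set μ := ∑ x, W x * f x with hμ
  have h1 : ∀ ω : Fin k → X,
      -- Exponential Markov inequality with parameter `τ / 2`. The final exponent is `k (-τ²/2 +
      -- τ²/4)`.
      (if k * μ + k * τ ≤ ∑ j, f (ω j) then ∏ j, W (ω j) else 0) ≤
        Real.exp (-(τ / 2 * (k * μ + k * τ))) * ∏ j, (W (ω j) * Real.exp (τ / 2 * f (ω j))) := by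
    intro ω
    have hp : 0 ≤ ∏ j, W (ω j) := Finset.prod_nonneg fun j _ => hW _
    rw [Finset.prod_mul_distrib, ← Real.exp_sum, ← Finset.mul_sum, mul_left_comm, ← Real.exp_add]
    split_ifs with h
    · refine le_mul_of_one_le_right hp (Real.one_le_exp ?_)
      have := mul_le_mul_of_nonneg_left h (by linarith : (0 : ℝ) ≤ τ / 2)
      linarith
    · exact mul_nonneg hp (Real.exp_nonneg _)
  refine (Finset.sum_le_sum fun ω _ => h1 ω).trans ?_
  rw [← Finset.mul_sum, sum_prod_weight W k fun x => Real.exp (τ / 2 * f x)]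
  have h3 : ∑ x, W x * Real.exp (τ / 2 * f x) ≤ Real.exp (τ / 2 * μ + (τ / 2) ^ 2) := by
    have h4 : ∀ x, W x * Real.exp (τ / 2 * f x) ≤
        W x + τ / 2 * (W x * f x) + W x * (τ / 2) ^ 2 := by
      intro x
      have hle : |τ / 2 * f x| ≤ 1 := by
        rw [abs_mul, abs_of_nonneg (by linarith : (0 : ℝ) ≤ τ / 2)]
        -- Here `τ ≤ 2` is needed, so that `exp y ≤ 1 + y + y²` applies on `|y| ≤ 1`.
        exact mul_le_one₀ (by linarith) (abs_nonneg _) (hf x)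
      have h5 := (abs_le.mp (Real.abs_exp_sub_one_sub_id_le hle)).2
      have h6 : (τ / 2 * f x) ^ 2 ≤ (τ / 2) ^ 2 := by
        rw [mul_pow]
        refine mul_le_of_le_one_right (sq_nonneg _) ?_
        rw [← sq_abs]
        exact pow_le_one₀ (abs_nonneg _) (hf x)
      have h7 : Real.exp (τ / 2 * f x) ≤ 1 + τ / 2 * f x + (τ / 2) ^ 2 := by linarith
      calc W x * Real.exp (τ / 2 * f x) ≤ W x * (1 + τ / 2 * f x + (τ / 2) ^ 2) :=
            mul_le_mul_of_nonneg_left h7 (hW x)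
        _ = _ := by ring
    refine (Finset.sum_le_sum fun x _ => h4 x).trans ?_
    rw [Finset.sum_add_distrib, Finset.sum_add_distrib, ← Finset.mul_sum, ← Finset.sum_mul, hW1,
      ← hμ]
    have := Real.add_one_le_exp (τ / 2 * μ + (τ / 2) ^ 2)
    linarith
  calc _ ≤ Real.exp (-(τ / 2 * (k * μ + k * τ))) * Real.exp (τ / 2 * μ + (τ / 2) ^ 2) ^ k := by
        refine mul_le_mul_of_nonneg_left (pow_le_pow_left₀ ?_ h3 k) (Real.exp_nonneg _)
        exact Finset.sum_nonneg fun x _ => mul_nonneg (hW x) (Real.exp_nonneg _)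
    _ = _ := by
        rw [← Real.exp_nat_mul, ← Real.exp_add]
        congr 1
        ring

open Classical in
/-- Simultaneous concentration of finitely many statistics. -/
lemma concentration {ι : Type} [Fintype ι] (hW : ∀ x, 0 ≤ W x) (hW1 : ∑ x, W x = 1) (k : ℕ)
    (f : ι → X → ℝ) (hf : ∀ a x, |f a x| ≤ 1) (τ : ℝ) (h0 : 0 ≤ τ) (h2 : τ ≤ 2) :
    1 - Fintype.card ι * (2 * Real.exp (-(k * τ ^ 2 / 4))) ≤
      ∑ ω : Fin k → X, if ∀ a, |∑ j, f a (ω j) - k * ∑ x, W x * f a x| < k * τ then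
        ∏ j, W (ω j) else 0 := by
  have htot : ∑ ω : Fin k → X, ∏ j, W (ω j) = 1 := by
    have := sum_prod_weight W k fun _ => 1
    simpa [hW1] using this
  -- The union bound pointwise: a point outside the good event is charged to an upper tail of some
  -- `f a` or of some `-f a`.
  have hpt : ∀ ω : Fin k → X, ∏ j, W (ω j) ≤
      (if ∀ a, |∑ j, f a (ω j) - k * ∑ x, W x * f a x| < k * τ then ∏ j, W (ω j) else 0) +
      ∑ a, ((if k * (∑ x, W x * f a x) + k * τ ≤ ∑ j, f a (ω j) then ∏ j, W (ω j) else 0) +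
        if k * (∑ x, W x * -f a x) + k * τ ≤ ∑ j, -f a (ω j) then ∏ j, W (ω j) else 0) := by
    intro ω
    have hp : 0 ≤ ∏ j, W (ω j) := Finset.prod_nonneg fun j _ => hW _
    have hnn : ∀ a ∈ Finset.univ, 0 ≤
        ((if k * (∑ x, W x * f a x) + k * τ ≤ ∑ j, f a (ω j) then ∏ j, W (ω j) else 0) +
        if k * (∑ x, W x * -f a x) + k * τ ≤ ∑ j, -f a (ω j) then ∏ j, W (ω j) else 0) := by
      intro a _
      split_ifs <;> linarith
    by_cases h : ∀ a, |∑ j, f a (ω j) - k * ∑ x, W x * f a x| < k * τ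
    · rw [if_pos h]
      linarith [Finset.sum_nonneg hnn]
    · rw [if_neg h, zero_add]
      push Not at h
      obtain ⟨a, ha⟩ := h
      refine le_trans ?_ (Finset.single_le_sum hnn (Finset.mem_univ a))
      rcases le_abs.mp ha with h | h
      · rw [if_pos (by linarith)]
        split_ifs <;> linarith
      · rw [add_comm, if_pos (by simp only [mul_neg, Finset.sum_neg_distrib]; linarith)]
        split_ifs <;> linarith
  have hsum := Finset.sum_le_sum fun ω (_ : ω ∈ Finset.univ) => hpt ω
  rw [htot, Finset.sum_add_distrib, Finset.sum_comm] at hsum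
  have hbad : ∀ a ∈ Finset.univ, ∑ ω : Fin k → X,
      ((if k * (∑ x, W x * f a x) + k * τ ≤ ∑ j, f a (ω j) then ∏ j, W (ω j) else 0) +
        if k * (∑ x, W x * -f a x) + k * τ ≤ ∑ j, -f a (ω j) then ∏ j, W (ω j) else 0) ≤
      2 * Real.exp (-(k * τ ^ 2 / 4)) := by
    intro a _
    rw [Finset.sum_add_distrib, two_mul]
    exact add_le_add (chernoff W hW hW1 k (f a) (hf a) τ h0 h2)
      (chernoff W hW hW1 k (fun x => -f a x) (fun x => by rw [abs_neg]; exact hf a x) τ h0 h2)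
  have := Finset.sum_le_sum hbad
  rw [Finset.sum_const, Finset.card_univ, nsmul_eq_mul] at this
  linarith

end Concentration

/-! ### Analysis of the algorithm -/

/-- The bases of the samples `ω`, extended by zero. -/
def basisTable {k n : ℕ} (ω : Fin k → Fin n → ZMod 2 × ZMod 2) (j q : ℕ) : ZMod 2 :=
  if h : j < k ∧ q < n then (ω ⟨j, h.1⟩ ⟨q, h.2⟩).1 else 0

/-- The outcomes of the samples `ω`, extended by zero. -/
def outcomeTable {k n : ℕ} (ω : Fin k → Fin n → ZMod 2 × ZMod 2) (j q : ℕ) : ZMod 2 :=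
  if h : j < k ∧ q < n then (ω ⟨j, h.1⟩ ⟨q, h.2⟩).2 else 0

lemma basisTable_fin {k n : ℕ} (ω : Fin k → Fin n → ZMod 2 × ZMod 2) (j : Fin k) (q : Fin n) :
    basisTable ω j q = (ω j q).1 := by simp [basisTable]

lemma outcomeTable_fin {k n : ℕ} (ω : Fin k → Fin n → ZMod 2 × ZMod 2) (j : Fin k) (q : Fin n) :
    outcomeTable ω j q = (ω j q).2 := by simp [outcomeTable]

lemma MeasureInv.trace {k n w : ℕ} {hw : 0 < w} {ε : ℝ} {A : Matrix (Fin n) (Fin n) (ZMod 2)}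
    {ω : Fin k → Fin n → ZMod 2 × ZMod 2} {s : Store} {ρ : Op (Qubits k n w)}
    (h : MeasureInv hw (initState k w (localDepol ε (phaseState A))) k ω s ρ) :
    ρ.trace.re = ∏ j, sampleWeight ε A (ω j) := by
  obtain ⟨K, rfl, hW, -, hK⟩ := h.state
  rw [trace_initState, hW.prod_gram]
  have hK' : ∀ j q, K (Sum.inl (j, q)) = basisKraus (ω j q) := fun j q => hK j q j.2
  simp only [hK', trace_sample]
  have h2 : (((1 / 2 : ℝ) ^ (k * n) : ℝ) : ℂ) = (1 / 2 : ℂ) ^ (k * n) := by push_cast; rfl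
  rw [← Complex.ofReal_prod, ← h2, ← Complex.ofReal_mul, Complex.ofReal_re,
    Finset.prod_mul_distrib, Finset.prod_const, Finset.card_univ, Fintype.card_fin, ← pow_mul,
    mul_right_comm, mul_comm n k, ← mul_pow]
  norm_num

/-- A bound for the running time of the algorithm. -/
def learnTime (n k : ℕ) : ℕ := k * (n * (18 + 1) + 9 + 1) + postTime n k + 5

open Classical in
-- All randomness is in the measurements and the post-processing is deterministic, so the final
-- store is a function of the outcomes `ω`. This reduces the run to a finite product distribution.
lemma runProb_learner {n k T : ℕ} (hn : 0 < n) (hT : learnTime n k ≤ T) (ε : ℝ)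
    (A : Matrix (Fin n) (Fin n) (ZMod 2)) :
    ∃ fin : (Fin k → Fin n → ZMod 2 × ZMod 2) → Store,
      (∀ ω, ∀ i < n, RowCorrect n k (tableSize n) (basisTable ω) (outcomeTable ω) (rowVec n)
        (fin ω).mem i) ∧
      ∀ good, runProb learner k T T (localDepol ε (phaseState A)) good =
        ∑ ω, if good (fin ω) then ∏ j, sampleWeight ε A (ω j) else 0 := by
  have hw : 0 < T := by rw [learnTime] at hT; omega
  obtain ⟨S, R, hB, hI⟩ := branch_measureAll hw (initState k T (localDepol ε (phaseState A)))
  have hpost : ∀ ω, Wp (block postprocess) (postTime n k) (S ω) fun s' =>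
      ∀ i < n, RowCorrect n k (tableSize n) (basisTable ω) (outcomeTable ω) (rowVec n) s'.mem i := by
    intro ω
    have h := hI ω
    refine wp_postprocess hn (S ω) h.reg0 h.reg1 h.reg2 h.reg3 ?_ ?_ h.frame
    · intro j hj q hq
      rw [h.basis ⟨j, hj⟩ ⟨q, hq⟩, ← basisTable_fin]
    · intro j hj q hq
      rw [h.outcome ⟨j, hj⟩ ⟨q, hq⟩, ← outcomeTable_fin]
  choose fin hfin t ht hE using hpost
  refine ⟨fin, hfin, fun good => ?_⟩
  obtain ⟨f, hf, rfl⟩ : ∃ f, postTime n k ≤ f ∧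
      T = f + (k * (n * (18 + 1) + 9 + 1) + 1) + 1 + 1 + 1 := by
    rw [learnTime] at hT
    exact ⟨T - (k * (n * (18 + 1) + 9 + 1) + 4), by omega, by omega⟩
  rw [runProb, learner, block, haltProb, Exec.const, block, haltProb, hB]
  refine Finset.sum_congr rfl fun ω _ => ?_
  obtain ⟨f', hf'⟩ : ∃ f', f = f' + t ω := ⟨f - t ω, by have := ht ω; omega⟩
  have h := hE ω k n _ good f' [] (R ω)
  rw [← hf'] at h
  rw [h, haltProb, (hI ω).trace]

/-- Every sparse vector is a row of the table. -/
lemma exists_rowVec {n : ℕ} (hn : 2 ≤ n) (Z : Finset ℕ) :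
    (∀ q ∈ Z, q < n) → ∃ t, t + 2 ≤ 2 * n ^ Z.card ∧
      ∀ q, rowVec n t q = if q ∈ Z then 1 else 0 := by
  induction Z using Finset.induction_on with
  | empty => exact fun _ => ⟨0, by simp, fun q => by simp [rowVec]⟩
  | insert a Z ha ih =>
    intro h
    obtain ⟨t, ht, hr⟩ := ih fun q hq => h q (Finset.mem_insert_of_mem hq)
    have han := h a (Finset.mem_insert_self a Z)
    have hd : (n * t + a) / n = t ∧ (n * t + a) % n = a :=
      (Nat.div_mod_unique (by omega)).mpr ⟨by ring, han⟩
    -- The table is laid out like an `n`-ary heap: the child of row `t` that flips entry `a` is row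
    -- `n * t + a + 1`. The offset 2 in the bound closes the induction, since `n * t + a + 3 ≤ n *
    -- (t + 2)` for `a < n` and `2 ≤ n`.
    refine ⟨n * t + a + 1, ?_, fun q => ?_⟩
    · rw [Finset.card_insert_of_notMem ha, pow_succ]
      have := Nat.mul_le_mul_left n ht
      nlinarith
    · rw [rowVec, hd.1, hd.2, Pi.add_apply, hr]
      by_cases hq : q = a
      · subst hq; simp [ha]
      · simp [hq]

open Classical in
-- An unsuited basis makes some factor of the statistic vanish; otherwise the signs multiply to the
-- sign of the parity. Summed over the samples, the statistic becomes the vote difference that the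
-- program computes.
lemma testStat_eq {k n : ℕ} (ω : Fin k → Fin n → ZMod 2 × ZMod 2) (c : ℕ → ZMod 2) (i : Fin n)
    (j : Fin k) :
    testStat i (fun q => c q) (ω j) =
      (if Suited (basisTable ω j) c i n ∧ testParity (outcomeTable ω j) c i n = 0 then 1 else 0) -
      (if Suited (basisTable ω j) c i n ∧ testParity (outcomeTable ω j) c i n = 1 then 1 else 0) := by
  by_cases hs : Suited (basisTable ω j) c i n
  · have h1 : testStat i (fun q => c q) (ω j) = sgn (testParity (outcomeTable ω j) c i n) := by
      have hp : testParity (outcomeTable ω j) c i n =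
          ∑ q : Fin n, ((if q = i then (ω j q).2 else 0) + c q * (ω j q).2) := by
        rw [testParity, Finset.sum_range, Finset.sum_add_distrib, outcomeTable_fin]
        simp [outcomeTable_fin]
      rw [hp, sgn_sum, testStat]
      refine Finset.prod_congr rfl fun q _ => ?_
      rw [sgn_add, testFactor]
      congr 1
      · by_cases hq : q = i
        · have := hs.1
          rw [basisTable_fin] at this
          simp [hq, this]
        · simp [hq, sgn_zero]
      · rcases ZMod.two_cases (c q) with h | h
        · simp [h, sgn_zero]
        · have := hs.2 q q.2 h
          rw [basisTable_fin] at this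
          simp [h, this]
    rw [h1]
    rcases ZMod.two_cases (testParity (outcomeTable ω j) c i n) with h | h <;>
      simp [h, hs, sgn_zero, sgn_one]
  · rw [if_neg (fun h => hs h.1), if_neg (fun h => hs h.1), sub_zero, testStat]
    by_cases hi : basisTable ω j i = 1
    · have : ∃ q < n, c q = 1 ∧ basisTable ω j q ≠ 0 := by
        by_contra hcon
        push Not at hcon
        exact hs ⟨hi, hcon⟩
      obtain ⟨q, hq, h1, h2⟩ := this
      refine Finset.prod_eq_zero (Finset.mem_univ ⟨q, hq⟩) ?_
      have h3 := basisTable_fin ω j ⟨q, hq⟩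
      simp only at h3
      rw [h3] at h2
      simp [testFactor, h1, h2]
    · refine Finset.prod_eq_zero (Finset.mem_univ i) ?_
      rw [basisTable_fin] at hi
      simp [testFactor, hi]

lemma sum_testStat_eq {k n : ℕ} (ω : Fin k → Fin n → ZMod 2 × ZMod 2) (c : ℕ → ZMod 2)
    (i : Fin n) :
    ∑ j, testStat i (fun q => c q) (ω j) =
      (votes (basisTable ω) (outcomeTable ω) c i n 0 k : ℝ) -
        votes (basisTable ω) (outcomeTable ω) c i n 1 k := by
  classical
  simp only [testStat_eq, Finset.sum_sub_distrib, votes, Finset.sum_range, Nat.cast_sum,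
    Nat.cast_ite, Nat.cast_one, Nat.cast_zero]

lemma card_row_le {n : ℕ} (A : Matrix (Fin n) (Fin n) (ZMod 2)) (i : Fin n) :
    (Finset.univ.filter fun q => (A + A.transpose) i q = 1).card ≤ graphDegree A := by
  have h := Finset.le_sup (f := fun i => (Finset.univ.filter fun j =>
    (A + A.transpose) i j ≠ 0).card) (Finset.mem_univ i)
  refine le_trans (Finset.card_le_card fun q hq => ?_) h
  simp only [Finset.mem_filter, Finset.mem_univ, true_and] at hq ⊢
  rw [hq]
  exact one_ne_zero

/-- If all test statistics are close to their expectations, then the output is correct. -/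
lemma outputs_of_concentration {n k : ℕ} (hn : 2 ≤ n) {ε τ : ℝ} (h0 : 0 < ε) (h1 : ε < 1)
    (hτ : 0 ≤ τ)
    (A : Matrix (Fin n) (Fin n) (ZMod 2)) (hA : ∀ i j, j < i → A i j = 0)
    (hd : 2 * τ ≤ ((1 - ε) / 2) ^ (graphDegree A + 1))
    (hM : 2 * n ^ graphDegree A ≤ tableSize n + 1)
    (ω : Fin k → Fin n → ZMod 2 × ZMod 2)
    (hω : ∀ p : Fin n × Bits (Fin n),
      |∑ j, testStat p.1 p.2 (ω j) - k * testMean ε A p.1 p.2| < k * τ)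
    (s : Store) (hs : ∀ i < n, RowCorrect n k (tableSize n) (basisTable ω) (outcomeTable ω)
      (rowVec n) s.mem i) : Outputs A s := by
  intro i j
  obtain ⟨best, u, huM, hb, hup, hlow⟩ := hs i i.2
  set D : ℕ → ℝ := fun t => ∑ j, testStat i (fun q => rowVec n t q) (ω j) with hD
  have hDv : ∀ t, D t = (votes (basisTable ω) (outcomeTable ω) (rowVec n t) i n 0 k : ℝ) -
      votes (basisTable ω) (outcomeTable ω) (rowVec n t) i n 1 k :=
    fun t => sum_testStat_eq ω (rowVec n t) i
  have hneg : ∀ t, (fun q : Fin n => rowVec n t q) ≠ (A + A.transpose) i → |D t| < k * τ := by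
    intro t ht
    have := hω (i, fun q => rowVec n t q)
    rwa [testMean, if_neg ht, mul_zero, sub_zero] at this
  -- The threshold `k * τ` separates the candidates: the mean of the true row is at least `2 τ` in
  -- absolute value and the deviation is below `τ`, while all other rows have mean zero.
  have hpos : ∀ t, (fun q : Fin n => rowVec n t q) = (A + A.transpose) i →
      k * τ < sgn (A i i) * D t := by
    intro t ht
    have h2 := hω (i, fun q => rowVec n t q)
    have hcard : (Finset.univ.filter fun q : Fin n => q = i ∨ rowVec n t q = 1).card ≤
        graphDegree A + 1 := by
      rw [Finset.filter_or]
      refine (Finset.card_union_le _ _).trans ?_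
      have h3 := card_row_le A i
      rw [← ht] at h3
      beta_reduce at h3
      rw [Finset.filter_eq' Finset.univ i, if_pos (Finset.mem_univ i), Finset.card_singleton]
      omega
    rw [testMean, if_pos ht] at h2
    have hmean : 2 * τ ≤ ((1 - ε) / 2) ^
        (Finset.univ.filter fun q : Fin n => q = i ∨ rowVec n t q = 1).card :=
      hd.trans (pow_le_pow_of_le_one (by linarith) (by linarith) hcard)
    set p := ((1 - ε) / 2) ^ (Finset.univ.filter fun q : Fin n => q = i ∨ rowVec n t q = 1).card
    have hk : (k : ℝ) * (2 * τ) ≤ k * p := mul_le_mul_of_nonneg_left hmean (Nat.cast_nonneg k)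
    have h4 := abs_lt.mp h2
    change _ < D t - _ ∧ D t - _ < _ at h4
    rcases ZMod.two_cases (A i i) with h | h
    · rw [h, sgn_zero] at h4 ⊢
      linarith [h4.1]
    · rw [h, sgn_one] at h4 ⊢
      linarith [h4.2]
  have hkτ : 0 ≤ k * τ := mul_nonneg (Nat.cast_nonneg k) hτ
  obtain ⟨t, ht, hrow⟩ : ∃ t < tableSize n, (fun q : Fin n => rowVec n t q) =
      (A + A.transpose) i := by
    obtain ⟨t, ht, hr⟩ := exists_rowVec hn ((Finset.univ.filter fun q =>
      (A + A.transpose) i q = 1).map Fin.valEmbedding) (by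
        intro q hq
        obtain ⟨q', -, rfl⟩ := Finset.mem_map.mp hq
        exact q'.2)
    refine ⟨t, ?_, ?_⟩
    · rw [Finset.card_map] at ht
      have := Nat.pow_le_pow_right (by omega : 0 < n) (card_row_le A i)
      omega
    · ext q
      simp only [hr, Finset.mem_map, Finset.mem_filter, Finset.mem_univ, true_and,
        Fin.valEmbedding_apply, Fin.val_inj, exists_eq_right]
      rcases ZMod.two_cases ((A + A.transpose) i q) with h | h <;> simp [h]
  have hbest : k * τ < best := by
    have h2 := hpos t hrow
    have h3 := hb.le_left t ht
    have h4 := hb.le_right t ht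
    have h3' : (votes (basisTable ω) (outcomeTable ω) (rowVec n t) i n 0 k : ℝ) ≤
      votes (basisTable ω) (outcomeTable ω) (rowVec n t) i n 1 k + best := by exact_mod_cast h3
    have h4' : (votes (basisTable ω) (outcomeTable ω) (rowVec n t) i n 1 k : ℝ) ≤
      votes (basisTable ω) (outcomeTable ω) (rowVec n t) i n 0 k + best := by exact_mod_cast h4
    rw [hDv] at h2
    rcases ZMod.two_cases (A i i) with h | h
    · rw [h, sgn_zero] at h2
      linarith
    · rw [h, sgn_one] at h2
      linarith
  rcases hb.attained with h | ⟨-, h⟩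
  · rw [h, Nat.cast_zero] at hbest
    linarith
  have hDu : s.mem i i = 0 ∧ D u = best ∨ s.mem i i = 1 ∧ D u = -best := by
    rw [hDv]
    rcases h with ⟨hg, h⟩ | ⟨hg, h⟩
    · refine Or.inl ⟨hg, ?_⟩
      rw [← h]; push_cast; ring
    · refine Or.inr ⟨hg, ?_⟩
      rw [← h]; push_cast; ring
  -- The winner scores above the threshold, which no wrong candidate does. The winning index may
  -- differ from `t`, as a vector can occur several times in the table.
  have hu : (fun q : Fin n => rowVec n u q) = (A + A.transpose) i := by
    by_contra hne
    have h2 := abs_lt.mp (hneg u hne)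
    rcases hDu with ⟨-, h⟩ | ⟨-, h⟩ <;> linarith [h2.1, h2.2]
  have hdiag : s.mem i i = (A i i).val := by
    have h2 := hpos u hu
    rcases ZMod.two_cases (A i i) with h | h <;> rcases hDu with ⟨hg, h'⟩ | ⟨hg, h'⟩ <;>
      rw [h, h'] at h2 <;> simp only [sgn_zero, sgn_one] at h2
    · rw [hg, h]; rfl
    · linarith
    · linarith
    · rw [hg, h]; rfl
  rcases lt_trichotomy i j with hij | rfl | hij
  -- Above the diagonal `A` agrees with `A + Aᵀ`, because `A` is upper triangular.
  · rw [hup j j.2 hij, show rowVec n u j = _ from congrFun hu j, Matrix.add_apply,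
      Matrix.transpose_apply, hA j i hij, add_zero]
  · exact hdiag
  · rw [hlow j hij, hA i j hij]
    rfl

/-! ### Asymptotics -/

open Filter Topology

lemma tendsto_logb_natCast : Tendsto (fun n : ℕ => Real.logb 2 n) atTop atTop :=
  (Real.tendsto_logb_atTop (by norm_num)).comp tendsto_natCast_atTop_atTop

lemma eventually_logb_sq_le_sqrt :
    ∀ᶠ n : ℕ in atTop, Real.logb 2 n ^ 2 + 1 ≤ Real.sqrt n := by
  have h2 : 0 < Real.log 2 := Real.log_pos (by norm_num)
  -- Applied at `√n`, where `log √n` is half of `log n`. The constant gives `(log₂ n)² ≤ √n / 2`,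
  -- which leaves room for the summand 1.
  have ho := (Real.isLittleO_pow_log_id_atTop (n := 2)).bound
    (show (0 : ℝ) < Real.log 2 ^ 2 / 8 by positivity)
  have ht : Tendsto (fun n : ℕ => Real.sqrt n) atTop atTop :=
    Real.tendsto_sqrt_atTop.comp tendsto_natCast_atTop_atTop
  filter_upwards [ht.eventually ho, ht.eventually_ge_atTop 2] with n hn hn2
  rw [Real.norm_of_nonneg (sq_nonneg _), id, Real.norm_of_nonneg (Real.sqrt_nonneg _),
    Real.log_sqrt (Nat.cast_nonneg n)] at hn
  have h3 : Real.logb 2 n ^ 2 ≤ Real.sqrt n / 2 := by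
    rw [Real.logb, div_pow, div_le_iff₀ (by positivity)]
    linarith
  linarith

/-- This is where `δ' < 1` enters: `d = o(log n)`, so `h ^ (d + 1)` decays more slowly than any
fixed negative power of `n`. Writing `h = 2^(-a)` and `l = log₂ n`, both `a * d` and `a` are
eventually at most `l / 16`. -/
lemma eventually_sparse {δ' h : ℝ} (hδ : δ' < 1) (h0 : 0 < h) (h1 : h < 1) :
    ∀ᶠ n : ℕ in atTop, ∀ d : ℕ, (d : ℝ) < Real.logb 2 n ^ δ' →
      (d : ℝ) ≤ Real.logb 2 n ∧ (n : ℝ) ^ (-(1 / 8) : ℝ) ≤ h ^ (d + 1) := by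
  set a : ℝ := -Real.logb 2 h with ha
  have ha0 : 0 < a := by
    rw [ha, neg_pos]
    exact Real.logb_neg (by norm_num) h0 h1
  have hlim : Tendsto (fun l : ℝ => l ^ (-(1 - δ'))) atTop (𝓝 0) :=
    tendsto_rpow_neg_atTop (by linarith)
  have hev := tendsto_logb_natCast.eventually
    (hlim.eventually_le_const (show (0 : ℝ) < 1 / (16 * a) by positivity))
  filter_upwards [hev, tendsto_logb_natCast.eventually_ge_atTop 1,
    tendsto_logb_natCast.eventually_ge_atTop (16 * a), eventually_gt_atTop 0] with n h2 h3 h4 hn d hd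
  set l := Real.logb 2 n with hl
  have hl0 : 0 < l := by linarith
  refine ⟨?_, ?_⟩
  · refine hd.le.trans ((Real.rpow_le_rpow_of_exponent_le h3 hδ.le).trans ?_)
    rw [Real.rpow_one]
  · have h5 : l ^ δ' = l * l ^ (-(1 - δ')) := by
      conv_rhs => rw [← Real.rpow_one l, ← Real.rpow_mul hl0.le, ← Real.rpow_add hl0]
      congr 1
      ring
    have h6 : l ^ δ' ≤ l * (1 / (16 * a)) := by
      rw [h5]
      exact mul_le_mul_of_nonneg_left h2 hl0.le
    have h7 : a * d ≤ l / 16 := by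
      calc a * d ≤ a * (l * (1 / (16 * a))) :=
            mul_le_mul_of_nonneg_left (hd.le.trans h6) ha0.le
        _ = l / 16 := by field_simp
    have hn' : (n : ℝ) = 2 ^ l := by
      rw [hl, Real.rpow_logb (by norm_num) (by norm_num) (by exact_mod_cast hn)]
    have hh : h = 2 ^ (-a) := by
      rw [ha, neg_neg, Real.rpow_logb (by norm_num) (by norm_num) h0]
    rw [hn', hh, ← Real.rpow_natCast, ← Real.rpow_mul (by norm_num), ← Real.rpow_mul (by norm_num)]
    refine Real.rpow_le_rpow_of_exponent_le (by norm_num) ?_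
    push_cast
    linarith

lemma sqrt_le_natSqrt_add_one {n : ℕ} (hn : 0 < n) :
    Real.sqrt n ≤ ((Nat.sqrt (n - 1) + 1 : ℕ) : ℝ) := by
  rw [Real.sqrt_le_left (Nat.cast_nonneg _)]
  have := Nat.sqrt_lt'.mp (Nat.lt_succ_self (Nat.sqrt (n - 1)))
  have h : n ≤ (Nat.sqrt (n - 1) + 1) ^ 2 := by
    simp only [Nat.succ_eq_add_one] at this
    omega
  exact_mod_cast h

/-- On the logarithmic scale this is `1 + (log₂ n)² ≤ √n`, so the table reaches all vectors of
weight at most `log₂ n`. -/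
lemma eventually_tableSize_ge : ∀ᶠ n : ℕ in atTop, ∀ d : ℕ, (d : ℝ) ≤ Real.logb 2 n →
    2 * n ^ d ≤ tableSize n + 1 := by
  filter_upwards [eventually_logb_sq_le_sqrt, eventually_gt_atTop 0,
    tendsto_logb_natCast.eventually_ge_atTop 1] with n h1 hn h3 d hd
  have h2 : ((2 * n ^ d : ℕ) : ℝ) ≤ (tableSize n : ℝ) := by
    have hn' : (n : ℝ) = 2 ^ Real.logb 2 n := by
      rw [Real.rpow_logb (by norm_num) (by norm_num) (by exact_mod_cast hn)]
    calc ((2 * n ^ d : ℕ) : ℝ) = 2 ^ (1 + Real.logb 2 n * d) := by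
          rw [Real.rpow_add (by norm_num), Real.rpow_mul (by norm_num), ← hn', Real.rpow_one,
            Real.rpow_natCast]
          push_cast; ring
      _ ≤ 2 ^ (((Nat.sqrt (n - 1) + 1 : ℕ) : ℝ)) := by
          refine Real.rpow_le_rpow_of_exponent_le (by norm_num) ?_
          refine le_trans ?_ (sqrt_le_natSqrt_add_one hn)
          nlinarith
      _ = _ := by rw [Real.rpow_natCast, tableSize]; push_cast; ring
  have h4 : 2 * n ^ d ≤ tableSize n := by exact_mod_cast h2
  omega

/-! ### Running time -/

lemma learnTime_le {n k : ℕ} (hn : 0 < n) (hk : 0 < k) :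
    learnTime n k ≤ 1000 * (n * n * k * tableSize n) := by
  have hM : 0 < tableSize n := Nat.two_pow_pos _
  have hs : Nat.sqrt (n - 1) ≤ n := (Nat.sqrt_le_self _).trans (Nat.sub_le _ _)
  rw [learnTime, postTime]
  generalize tableSize n = M at hM
  have e1 : k * n ≤ n * n * k * M := by
    calc k * n = 1 * n * k * 1 := by ring
      _ ≤ n * n * k * M := by gcongr <;> omega
  have e2 : M * n ≤ n * n * k * M := by
    calc M * n = 1 * n * 1 * M := by ring
      _ ≤ n * n * k * M := by gcongr <;> omega
  have e3 : n * n ≤ n * n * k * M := by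
    calc n * n = n * n * 1 * 1 := by ring
      _ ≤ n * n * k * M := by gcongr <;> omega
  have e4 : n * M * k ≤ n * n * k * M := by
    calc n * M * k = 1 * n * k * M := by ring
      _ ≤ n * n * k * M := by gcongr <;> omega
  have e5 : k ≤ k * n := Nat.le_mul_of_pos_right k hn
  have e6 : M ≤ M * n := Nat.le_mul_of_pos_right M hn
  have e7 : n ≤ n * n := Nat.le_mul_of_pos_right n hn
  generalize hN : n * n * k * M = N at e1 e2 e3 e4
  have e8 : k * (n * (18 + 1) + 9 + 1) = 19 * (k * n) + 10 * k := by ring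
  have e9 : M * (n * (10 + 1) + 30 + 1) = 11 * (M * n) + 31 * M := by ring
  have e10 : n * (M * (k * (n * (30 + 1) + 30 + 1) + 60 + 1) + n * (10 + 1) + 40 + 1) =
      31 * N + 31 * (n * M * k) + 61 * (M * n) + 11 * (n * n) + 41 * n := by
    rw [← hN]; ring
  rw [e8, e9, e10]
  omega

lemma eventually_learnTime_le : ∀ᶠ n : ℕ in atTop, ∀ k : ℕ, 0 < k → k ≤ 2 * n ^ 2 →
    learnTime n k ≤ ⌊(n : ℝ) * 2 ^ ((1 : ℝ) * (n / Real.logb 2 (Real.logb 2 n)))⌋₊ := by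
  filter_upwards [eventually_logb_sq_le_sqrt, eventually_gt_atTop 0,
    tendsto_logb_natCast.eventually_ge_atTop 6] with n h1 hn h3 k hk hk2
  refine (learnTime_le hn hk).trans (Nat.le_floor ?_)
  set l := Real.logb 2 n with hl
  set y := Real.sqrt n with hy
  have hn0 : (0 : ℝ) < n := by exact_mod_cast hn
  have hyy : y * y = n := Real.mul_self_sqrt hn0.le
  have hn' : (n : ℝ) = 2 ^ l := by
    rw [hl, Real.rpow_logb (by norm_num) (by norm_num) hn0]
  have hM : (tableSize n : ℝ) ≤ 2 ^ (y + 1) := by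
    rw [tableSize]
    push_cast
    rw [← Real.rpow_natCast]
    refine Real.rpow_le_rpow_of_exponent_le (by norm_num) ?_
    push_cast
    have : ((Nat.sqrt (n - 1) : ℕ) : ℝ) ≤ y := by
      rw [hy]
      refine Real.le_sqrt_of_sq_le ?_
      have := Nat.sqrt_le' (n - 1)
      have h5 : Nat.sqrt (n - 1) ^ 2 ≤ n := by omega
      exact_mod_cast h5
    linarith
  have hL : 0 < Real.logb 2 l ∧ Real.logb 2 l ≤ 2 * l := by
    refine ⟨Real.logb_pos (by norm_num) (by linarith), ?_⟩
    rw [Real.logb, div_le_iff₀ (Real.log_pos (by norm_num))]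
    have h5 := Real.log_le_sub_one_of_pos (show 0 < l by linarith)
    have h6 := Real.log_two_gt_d9
    nlinarith
  -- The exponent budget: `2^12` absorbs the constant `4000`, `3 * l` accounts for `n^3`, and `y =
  -- √n` for the table. The crude bound `log₂ l ≤ 2 l` suffices because `y ^ 2 = n` dominates `4 * y
  -- * l`.
  have hexp : 12 + 3 * l + y ≤ n / Real.logb 2 l := by
    rw [le_div_iff₀ hL.1]
    have h5 : 12 + 3 * l ≤ y := by nlinarith
    have h6 : 4 * l ≤ y := by nlinarith
    calc (12 + 3 * l + y) * Real.logb 2 l ≤ (2 * y) * (2 * l) :=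
          mul_le_mul (by linarith) hL.2 hL.1.le (by linarith)
      _ ≤ n := by rw [← hyy]; nlinarith
  have hk' : (k : ℝ) ≤ 2 * (n : ℝ) ^ 2 := by exact_mod_cast hk2
  have h2l : (2 : ℝ) ^ (12 + 3 * l + y) = 4096 * (n : ℝ) ^ 3 * 2 ^ y := by
    rw [Real.rpow_add (by norm_num), Real.rpow_add (by norm_num), mul_comm 3 l,
      Real.rpow_mul (by norm_num), ← hn']
    norm_num
  have hy1 : (2 : ℝ) ^ (y + 1) = 2 * 2 ^ y := by
    rw [Real.rpow_add (by norm_num), Real.rpow_one, mul_comm]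
  push_cast
  calc 1000 * ((n : ℝ) * n * k * tableSize n)
      ≤ 1000 * ((n : ℝ) * n * (2 * (n : ℝ) ^ 2) * 2 ^ (y + 1)) := by gcongr
    _ = (n : ℝ) * (4000 * (n : ℝ) ^ 3 * 2 ^ y) := by rw [hy1]; ring
    _ ≤ (n : ℝ) * (4096 * (n : ℝ) ^ 3 * 2 ^ y) := by gcongr; norm_num
    _ ≤ n * 2 ^ ((1 : ℝ) * (n / Real.logb 2 l)) := by
        rw [← h2l, one_mul]
        gcongr
        norm_num

/-! ### Number of samples and failure probability -/

lemma sampleCount_bounds {n k : ℕ} (hn : 0 < n) (hk : k = ⌊2 * (n : ℝ) ^ (1 + 1 / 2 : ℝ)⌋₊) :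
    (n : ℝ) ^ (3 / 2 : ℝ) ≤ k ∧ k ≤ 2 * n ^ 2 := by
  have hn1 : (1 : ℝ) ≤ n := by exact_mod_cast hn
  have e : (1 + 1 / 2 : ℝ) = 3 / 2 := by norm_num
  rw [e] at hk
  have h1 : (1 : ℝ) ≤ (n : ℝ) ^ (3 / 2 : ℝ) := Real.one_le_rpow hn1 (by norm_num)
  constructor
  · have := Nat.lt_floor_add_one (2 * (n : ℝ) ^ (3 / 2 : ℝ))
    rw [← hk] at this
    linarith
  · have h2 : (k : ℝ) ≤ 2 * (n : ℝ) ^ (3 / 2 : ℝ) := by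
      rw [hk]; exact Nat.floor_le (by positivity)
    have h3 : (n : ℝ) ^ (3 / 2 : ℝ) ≤ (n : ℝ) ^ (2 : ℝ) :=
      Real.rpow_le_rpow_of_exponent_le hn1 (by norm_num)
    rw [Real.rpow_two] at h3
    have : (k : ℝ) ≤ 2 * (n : ℝ) ^ 2 := by linarith
    exact_mod_cast this

lemma eventually_failure_le : ∀ᶠ n : ℕ in atTop, ∀ k : ℕ, (n : ℝ) ^ (3 / 2 : ℝ) ≤ k →
    (Fintype.card (Fin n × Bits (Fin n)) : ℝ) *
      (2 * Real.exp (-(k * ((n : ℝ) ^ (-(1 / 8) : ℝ) / 2) ^ 2 / 4))) ≤ 2 ^ (-(1 * n) : ℝ) := by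
  have ht : Tendsto (fun n : ℕ => (n : ℝ) ^ (1 / 4 : ℝ)) atTop atTop :=
    (tendsto_rpow_atTop (by norm_num)).comp tendsto_natCast_atTop_atTop
  filter_upwards [ht.eventually_ge_atTop 128, eventually_gt_atTop 0] with n h1 hn k hk
  have hn0 : (0 : ℝ) < n := by exact_mod_cast hn
  -- The Chernoff exponent is at least `n^(5/4) / 16`, which is superlinear and so beats the `n *
  -- 2^n` tests; `n^(1/4) ≥ 128` makes it at least `8 n`.
  have h2 : 8 * (n : ℝ) ≤ k * ((n : ℝ) ^ (-(1 / 8) : ℝ) / 2) ^ 2 / 4 := by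
    have e1 : ((n : ℝ) ^ (-(1 / 8) : ℝ)) ^ 2 = (n : ℝ) ^ (-(1 / 4) : ℝ) := by
      rw [← Real.rpow_natCast, ← Real.rpow_mul hn0.le]
      norm_num
    have e2 : (n : ℝ) ^ (3 / 2 : ℝ) * (n : ℝ) ^ (-(1 / 4) : ℝ) = n * (n : ℝ) ^ (1 / 4 : ℝ) := by
      rw [← Real.rpow_add hn0]
      nth_rewrite 2 [← Real.rpow_one (n : ℝ)]
      rw [← Real.rpow_add hn0]
      norm_num
    have h3 : (n : ℝ) ^ (3 / 2 : ℝ) * (n : ℝ) ^ (-(1 / 4) : ℝ) ≤ k * (n : ℝ) ^ (-(1 / 4) : ℝ) :=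
      mul_le_mul_of_nonneg_right hk (Real.rpow_nonneg hn0.le _)
    rw [div_pow, e1]
    rw [e2] at h3
    nlinarith
  have h3 : Real.exp (-(k * ((n : ℝ) ^ (-(1 / 8) : ℝ) / 2) ^ 2 / 4)) ≤ (1 / 2) ^ (8 * n) := by
    have e : Real.exp (-(1 : ℝ)) ≤ 1 / 2 := by
      rw [Real.exp_neg, ← one_div]
      exact one_div_le_one_div_of_le (by norm_num) (by linarith [Real.add_one_le_exp (1 : ℝ)])
    calc _ ≤ Real.exp (((8 * n : ℕ) : ℝ) * (-1)) := by
          refine Real.exp_le_exp.mpr ?_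
          push_cast
          linarith
      _ = Real.exp (-1) ^ (8 * n) := Real.exp_nat_mul _ _
      _ ≤ _ := pow_le_pow_left₀ (Real.exp_nonneg _) e _
  have hc : (Fintype.card (Fin n × Bits (Fin n)) : ℝ) = n * 2 ^ n := by simp [Bits]
  have h4 : (n : ℝ) ≤ 2 ^ n := by exact_mod_cast Nat.lt_two_pow_self.le
  have h5 : (2 : ℝ) ≤ 2 ^ n := by
    calc (2 : ℝ) = 2 ^ 1 := by norm_num
      _ ≤ 2 ^ n := pow_le_pow_right₀ (by norm_num) hn
  have e0 : (2 : ℝ) ^ (-(1 * n) : ℝ) = ((2 : ℝ) ^ n)⁻¹ := by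
    rw [one_mul, Real.rpow_neg (by norm_num), Real.rpow_natCast]
  rw [hc, e0]
  calc (n : ℝ) * 2 ^ n * (2 * Real.exp (-(k * ((n : ℝ) ^ (-(1 / 8) : ℝ) / 2) ^ 2 / 4)))
      ≤ 2 ^ n * 2 ^ n * (2 ^ n * (1 / 2) ^ (8 * n)) := by gcongr
    _ = ((2 : ℝ) ^ n)⁻¹ * (1 / 2) ^ (4 * n) := by
        rw [← inv_pow, show (2 : ℝ)⁻¹ = 1 / 2 by norm_num]
        have e3 : (2 : ℝ) ^ n * (1 / 2) ^ n = 1 := by rw [← mul_pow]; norm_num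
        calc (2 : ℝ) ^ n * 2 ^ n * (2 ^ n * (1 / 2) ^ (8 * n))
            = (2 ^ n * (1 / 2) ^ n) ^ 3 * (1 / 2) ^ (n + 4 * n) := by
              rw [show 8 * n = n + n + n + (n + 4 * n) by ring, pow_add, pow_add, pow_add]
              ring
          _ = _ := by rw [e3]; ring
    _ ≤ ((2 : ℝ) ^ n)⁻¹ := mul_le_of_le_one_right (by positivity)
        (pow_le_one₀ (by norm_num) (by norm_num))


end PhaseLearn

/-! ### Choice of the constants and conclusion -/

theorem mainTheorem9 (ε δ' : ℝ) (hε0 : 0 < ε) (hε1 : ε < 1) (hδ' : δ' < 1) :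
    ∃ δ : ℝ, 0 < δ ∧ δ < 1 ∧
    ∃ (P : PhaseLearn.Prog) (C c : ℝ) (n₀ : ℕ), 0 < C ∧ 0 < c ∧
      ∀ n : ℕ, n₀ ≤ n →
      ∀ k T : ℕ, k = ⌊2 * (n : ℝ) ^ (1 + δ)⌋₊ →
        T = ⌊(n : ℝ) * 2 ^ (C * (n / Real.logb 2 (Real.logb 2 n)))⌋₊ →
      ∀ A : Matrix (Fin n) (Fin n) (ZMod 2), (∀ i j, j < i → A i j = 0) →
        (PhaseLearn.graphDegree A : ℝ) < (Real.logb 2 n) ^ δ' →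
        PhaseLearn.runProb P k T T (PhaseLearn.localDepol ε (PhaseLearn.phaseState A))
            (fun _ => True) = 1 ∧
        1 - (2 : ℝ) ^ (-(c * n)) ≤
          PhaseLearn.runProb P k T T (PhaseLearn.localDepol ε (PhaseLearn.phaseState A))
            (PhaseLearn.Outputs A) := by
  classical
  have hev := (PhaseLearn.eventually_sparse (h := (1 - ε) / 2) hδ' (by linarith)
    (by linarith)).and (PhaseLearn.eventually_tableSize_ge.and
      (PhaseLearn.eventually_learnTime_le.and (PhaseLearn.eventually_failure_le.and
        (Filter.eventually_ge_atTop 2))))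
  obtain ⟨n₀, hn₀⟩ := Filter.eventually_atTop.mp hev
  -- With `δ = 1/2` and `τ` of order `n^(-1/8)`, the exponent `k τ²` is of order `n^(5/4)`, hence
  -- superlinear. Only `n₀` depends on `ε` and `δ'`.
  refine ⟨1 / 2, by norm_num, by norm_num, PhaseLearn.learner, 1, 1, n₀, one_pos, one_pos, ?_⟩
  intro n hn k T hk hT A hA hdeg
  obtain ⟨hsparse, htable, htime, hfail, hn2⟩ := hn₀ n hn
  obtain ⟨hk1, hk2⟩ := PhaseLearn.sampleCount_bounds (by omega) hk
  have hn1 : (1 : ℝ) ≤ n := by exact_mod_cast (by omega : 1 ≤ n)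
  have hk0 : 0 < k := by
    have := (Real.one_le_rpow hn1 (show (0 : ℝ) ≤ 3 / 2 by norm_num)).trans hk1
    exact_mod_cast (by linarith : (0 : ℝ) < k)
  have hlt : PhaseLearn.learnTime n k ≤ T := by
    rw [hT]
    exact htime k hk0 hk2
  obtain ⟨hd1, hd2⟩ := hsparse _ hdeg
  obtain ⟨fin, hrow, hrun⟩ := PhaseLearn.runProb_learner (by omega) hlt ε A
  have hW := PhaseLearn.sampleWeight_nonneg hε0.le hε1.le A
  have hW1 := PhaseLearn.sum_sampleWeight ε A
  rw [hrun, hrun]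
  constructor
  -- Every branch halts in time, so the halting probability is the total mass of the product
  -- distribution.
  · have := PhaseLearn.sum_prod_weight (PhaseLearn.sampleWeight ε A) k fun _ => 1
    simpa [hW1] using this
  · set τ : ℝ := (n : ℝ) ^ (-(1 / 8) : ℝ) / 2 with hτ
    have hτ0 : 0 ≤ τ := by positivity
    have hτ2 : τ ≤ 2 := by
      have := Real.rpow_le_one_of_one_le_of_nonpos hn1 (show (-(1 / 8) : ℝ) ≤ 0 by norm_num)
      linarith
    have hconc := PhaseLearn.concentration (PhaseLearn.sampleWeight ε A) hW hW1 k
      (fun p : Fin n × PhaseLearn.Bits (Fin n) => PhaseLearn.testStat p.1 p.2)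
      (fun p => PhaseLearn.abs_testStat_le p.1 p.2) τ hτ0 hτ2
    refine le_trans (sub_le_sub_left (hfail k hk1) 1) (hconc.trans ?_)
    refine Finset.sum_le_sum fun ω _ => ?_
    -- The good event is contained in the event of correct output, so the two probabilities compare
    -- term by term.
    by_cases hω : ∀ p : Fin n × PhaseLearn.Bits (Fin n),
        |∑ j, PhaseLearn.testStat p.1 p.2 (ω j) -
          k * ∑ x, PhaseLearn.sampleWeight ε A x * PhaseLearn.testStat p.1 p.2 x| < k * τ
    · rw [if_pos hω, if_pos]
      simp only [PhaseLearn.sum_sampleWeight_mul_testStat] at hω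
      exact PhaseLearn.outputs_of_concentration hn2 hε0 hε1 hτ0 A hA
        (by rw [hτ]; linarith) (htable _ hd1) ω hω (fin ω) (hrow ω)
    · rw [if_neg hω]
      split_ifs
      · exact Finset.prod_nonneg fun j _ => hW _
      · exact le_rfl
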